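/- Let $G$ be a finite group with commutator subgroup $G'$, and write $\zeta(R)$ for the centre of a ring $R$. Let $e_1,\dots,e_t$ be the central primitive idempotents of $A=\mathbb{Q}[G]$, put $A_i=Ae_i$ and $F_i=\zeta(A_i)$, so that $A_i$ is a central simple algebra over the field $F_i$. For a square matrix $H\in M_n(A)$ let $H_i=He_i\in M_n(A_i)$, let $f_{H_i}(X)=\sum_{j=0}^{m_i}\alpha_{ij}X^j\in F_i[X]$, of degree $m_i$, be the reduced characteristic polynomial of $H_i$ in the central simple $F_i$-algebra $M_n(A_i)$, and define the generalised adjoint of $H$ as $$H^{\ast}=\sum_{i=1}^{t}(-1)^{m_i+1}\sum_{j=1}^{m_i}\alpha_{ij}H_i^{\,j-1}\in M_n(A).$$ Let the denominator ideal of $\mathbb{Z}[G]$ be the ideal $$\mathcal{H}(G)=\{x\in\zeta(\mathbb{Z}[G]) \mid xH^{\ast}\in M_n(\mathbb{Z}[G])\text{ for all } n\in\mathbb{N}\text{ and all }H\in M_n(\mathbb{Z}[G])\}$$ of $\zeta(\mathbb{Z}[G])$. Then $$\mathcal{H}(G)\cap\mathbb{Z}=|G'|\,\mathbb{Z}.$$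 -/

import Mathlib

open Polynomial
open scoped TensorProduct

noncomputable section

namespace DenominatorIdeal

section ReducedCharpoly

variable (F : Type*) {B : Type*} [Field F] [Ring B] [Algebra F B]

/-- `f` is the reduced characteristic polynomial of the element `b` of the central simple
`F`-algebra `B`: after identifying `Fᶜ ⊗[F] B` with a full matrix algebra over the algebraic
closure `Fᶜ` of `F`, the characteristic polynomial of `1 ⊗ b` is `f`. -/
def IsReducedCharpoly (b : B) (f : F[X]) : Prop :=
  ∃ (m : ℕ) (φ : (AlgebraicClosure F ⊗[F] B) ≃ₐ[AlgebraicClosure F]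
      Matrix (Fin m) (Fin m) (AlgebraicClosure F)),
    (φ (1 ⊗ₜ[F] b)).charpoly = f.map (algebraMap F (AlgebraicClosure F))

open scoped Classical in
/-- The reduced characteristic polynomial of an element `b` of a central simple `F`-algebra `B`.
It exists and is unique when `B` is finite-dimensional central simple over `F`
(the value `0` for other algebras is immaterial). -/
def reducedCharpoly (b : B) : F[X] :=
  if h : ∃ f : F[X], IsReducedCharpoly F b f then h.choose else 0

/-- The generalised adjoint of an element `b` of a central simple `F`-algebra `B`. If
`f = ∑_{j ≤ m} α_j X ^ j` is the (monic) reduced characteristic polynomial, of degree `m`,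
this is `(-1) ^ (m + 1) * ∑_{1 ≤ j ≤ m} α_j b ^ (j - 1)`. -/
def simpleAdjoint (b : B) : B :=
  (-1) ^ ((reducedCharpoly F b).natDegree + 1) *
    ∑ j ∈ Finset.Icc 1 (reducedCharpoly F b).natDegree,
      (reducedCharpoly F b).coeff j • b ^ (j - 1)

end ReducedCharpoly

/-- The central primitive idempotents of a ring `A`: the nonzero central idempotents `e` such
that the only central idempotents `f` with `f * e = f` are `0` and `e`. -/
structure CentralPrimitiveIdempotent (A : Type*) [Ring A] where
  /-- the underlying element -/
  e : A
  idem : IsIdempotentElem e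
  central : e ∈ Subring.center A
  ne_zero : e ≠ 0
  primitive : ∀ f : A, IsIdempotentElem f → f ∈ Subring.center A → f * e = f → f = 0 ∨ f = e

section Components

variable {A : Type*} [Ring A]

namespace CentralPrimitiveIdempotent

/-- The component `e A = A e = e A e` of `A`, a ring with identity `e`. -/
abbrev Component (ε : CentralPrimitiveIdempotent A) : Type _ := ε.idem.Corner

/-- The projection `a ↦ e * a * e` (which is `a * e`, as `e` is central) to the component. -/
def proj (ε : CentralPrimitiveIdempotent A) (a : A) : ε.Component := ⟨ε.e * a * ε.e, a, rfl⟩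

/-- In a semisimple ring, a nonzero central element of a component is invertible there. -/
theorem exists_inv [IsSemisimpleRing A] (ε : CentralPrimitiveIdempotent A)
    (x : Subring.center ε.Component) (hx : x ≠ 0) :
    ∃ y : Subring.center ε.Component, x * y = 1 := by
  obtain ⟨⟨x, hxe⟩, hxc⟩ := x
  have hmem := (Subsemigroup.mem_corner_iff ε.idem).mp hxe
  have hx0 : x ≠ 0 := by
    rintro rfl
    exact hx rfl
  have hec : ∀ a : A, a * ε.e = ε.e * a := fun a => Subring.mem_center_iff.mp ε.central a
  have hcomm : ∀ a : A, a * x = x * a := by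
    intro a
    have h := Subring.mem_center_iff.mp hxc (ε.proj a)
    have h' : ε.e * a * ε.e * x = x * (ε.e * a * ε.e) := congrArg Subtype.val h
    calc a * x = a * (ε.e * x) := by rw [hmem.1]
      _ = ε.e * a * ε.e * x := by
        rw [← mul_assoc, hec a, mul_assoc ε.e a ε.e, hec a, ← mul_assoc, ε.idem.eq]
      _ = x * (ε.e * a * ε.e) := h'
      _ = x * ε.e * a := by
        rw [mul_assoc ε.e a ε.e, hec a, ← mul_assoc ε.e ε.e a, ε.idem.eq, mul_assoc]
      _ = x * a := by rw [hmem.2]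
  obtain ⟨f, hf, hspan⟩ := IsSemisimpleRing.ideal_eq_span_idempotent (Ideal.span {x})
  have hfx : f ∈ Ideal.span {x} := hspan ▸ Ideal.mem_span_singleton_self f
  have hxf : x ∈ Ideal.span {f} := hspan ▸ Ideal.mem_span_singleton_self x
  obtain ⟨a, ha⟩ := Ideal.mem_span_singleton'.mp hfx
  obtain ⟨b, hb⟩ := Ideal.mem_span_singleton'.mp hxf
  have hxf' : x * f = x := by rw [← hb, mul_assoc, hf.eq]
  have hfx' : f * x = x := by rw [hcomm, hxf']
  have hfc : ∀ r : A, r * f = f * r := by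
    intro r
    have h1 : r * f = f * (r * f) := by
      calc r * f = r * a * (f * x) := by rw [hfx', mul_assoc, ha]
        _ = r * a * (x * f) := by rw [hcomm f]
        _ = (r * a * x) * f := by rw [mul_assoc (r * a)]
        _ = (x * (r * a)) * f := by rw [hcomm (r * a)]
        _ = (f * x * (r * a)) * f := by rw [hfx']
        _ = f * (x * (r * a) * f) := by simp only [mul_assoc]
        _ = f * (r * a * x * f) := by rw [hcomm (r * a)]
        _ = f * (r * a * (f * x)) := by rw [hcomm f, mul_assoc (r * a)]
        _ = f * (r * f) := by rw [hfx', mul_assoc r a x, ha]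
    have h2 : f * r = f * r * f := by
      have : f * r = a * r * x := by rw [← ha, mul_assoc, ← hcomm r, ← mul_assoc]
      rw [this, mul_assoc _ x f, hxf']
    rw [h1, h2, mul_assoc]
  have hfe : f * ε.e = f := by rw [← ha, mul_assoc, hmem.2]
  have hf0 : f ≠ 0 := by
    rintro rfl
    exact hx0 (by rw [← hxf', mul_zero])
  have hfe' : f = ε.e :=
    (ε.primitive f hf (Subring.mem_center_iff.mpr hfc) hfe).resolve_left hf0
  have hinv : x * (ε.e * a * ε.e) = ε.e := by
    rw [← hcomm, mul_assoc, hmem.1, mul_assoc, ha, hfe', ε.idem.eq]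
  have hinv' : ε.e * a * ε.e * x = ε.e := by rw [hcomm, hinv]
  set X : ε.Component := ⟨x, hxe⟩ with hX
  have hXY : X * ε.proj a = 1 := Subtype.ext hinv
  have hYX : ε.proj a * X = 1 := Subtype.ext hinv'
  refine ⟨⟨ε.proj a, Subring.mem_center_iff.mpr fun g => ?_⟩, Subtype.ext hXY⟩
  have hg := Subring.mem_center_iff.mp hxc g
  calc g * ε.proj a = ε.proj a * X * (g * ε.proj a) := by rw [hYX, one_mul]
    _ = ε.proj a * (X * g) * ε.proj a := by simp only [mul_assoc]
    _ = ε.proj a * (g * X) * ε.proj a := by rw [← hg]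
    _ = ε.proj a * g * (X * ε.proj a) := by simp only [mul_assoc]
    _ = ε.proj a * g := by rw [hXY, mul_one]

theorem component_one_ne_zero (ε : CentralPrimitiveIdempotent A) :
    (1 : Subring.center ε.Component) ≠ 0 := fun h =>
  ε.ne_zero (congrArg (fun z : Subring.center ε.Component => (z : ε.Component).val) h)

open scoped Classical in
/-- The centre of a component of a semisimple ring is a field. -/
instance centerField [IsSemisimpleRing A] (ε : CentralPrimitiveIdempotent A) :
    Field (Subring.center ε.Component) where
  __ := (inferInstance : CommRing (Subring.center ε.Component))
  inv x := if h : x ≠ 0 then (ε.exists_inv x h).choose else 0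
  exists_pair_ne := ⟨1, 0, ε.component_one_ne_zero⟩
  mul_inv_cancel x hx := by
    change x * (if h : x ≠ 0 then (ε.exists_inv x h).choose else 0) = 1
    rw [dif_pos hx]
    exact (ε.exists_inv x hx).choose_spec
  inv_zero := dif_neg (fun h => h rfl)
  nnqsmul := _
  nnqsmul_def := fun _ _ => rfl
  qsmul := _
  qsmul_def := fun _ _ => rfl

end CentralPrimitiveIdempotent

variable [IsSemisimpleRing A]

/-- The generalised adjoint `H^*` of a square matrix `H` over a semisimple ring `A` whose
components are finite-dimensional over their centres: the sum over the (finitely many) central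
primitive idempotents `e` of the generalised adjoints of `H e`, viewed in the matrix ring over
the component `A e`, which is a central simple algebra over the centre of `A e`. -/
def generalisedAdjoint {n : ℕ} (H : Matrix (Fin n) (Fin n) A) : Matrix (Fin n) (Fin n) A :=
  ∑ᶠ ε : CentralPrimitiveIdempotent A,
    (simpleAdjoint (Subring.center ε.Component) (H.map ε.proj)).map Subtype.val

/-- The denominator ideal of a subring `Λ` of `A`: all `x` in the centre of `Λ` such that
`x H^*` has entries in `Λ` for every square matrix `H` with entries in `Λ`. It is an ideal of
the centre of `Λ`. -/
def denominatorIdeal (Λ : Subring A) : Ideal (Subring.center Λ) where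
  carrier := {x | ∀ (n : ℕ) (H : Matrix (Fin n) (Fin n) A), (∀ i j, H i j ∈ Λ) →
    ∀ i j, ((x : Λ) : A) * generalisedAdjoint H i j ∈ Λ}
  zero_mem' := by
    intro n H _ i j
    simp
  add_mem' := by
    intro x y hx hy n H hH i j
    have h := Λ.add_mem (hx n H hH i j) (hy n H hH i j)
    rwa [← add_mul] at h
  smul_mem' := by
    intro c x hx n H hH i j
    have h := Λ.mul_mem (c : Λ).2 (hx n H hH i j)
    rwa [← mul_assoc] at h

end Components

/-- The integral group ring `ℤ[G]`, as a subring of the rational group algebra `ℚ[G]`. -/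
def integralGroupRing (G : Type*) [Group G] : Subring (MonoidAlgebra ℚ G) :=
  (MonoidAlgebra.mapRingHom G (Int.castRingHom ℚ)).range

end DenominatorIdeal

end

/-!
The component at a central primitive idempotent `e` of `ℚ[G]` is a central simple algebra over its
centre `F`. Let `K` be an algebraic closure of `ℚ`. A matrix representation `ψ : ℚ[G] → M_d(K)` whose
image spans `M_d(K)` factors through one component, identifies `K ⊗ M_n(ℚ[G] e)` with `M_{nd}(K)`, and
so carries the generalised adjoint `H^*` to the adjugate of `ψ(H)`
(`blockMap_generalisedAdjoint`). The reduced characteristic polynomial is identified through its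
`N`-th power, `N ^ 2 = dim_F M_n(ℚ[G] e)`, which is the characteristic polynomial of left
multiplication; this also shows that it has coefficients in `F`. As the representations `ψ` separate
the elements of `K[G]`, they determine `H^*`.

If `x` is an integer in the denominator ideal, take `n = 1` and `H = 0`. The adjugate of the zero
matrix of size `d` is `1` for `d = 1` and `0` otherwise, so `0^*` is the idempotent
`|G'|⁻¹ ∑_{g ∈ G'} g`, and `|G'|` divides `x`
(`natCard_commutator_mul_coeff_zeroAdjoint`, `natCard_commutator_dvd`).

Conversely let `H` be integral, let `O` be the ring of algebraic integers in `K`, and let `a` be an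
entry of `H^*`. Grade `ℚ[G]` by `T = G/G'`. For `h ∈ G` let `y ∈ ℚ[G']` be `h⁻¹` times the
homogeneous component of `a` of the degree of `h`. Then `y` has coefficient `a_h` at `1`, and
`|G'| a_h` is the trace of left multiplication by `y` on `K[G']`; so it suffices that `y` is integral
(`isIntegral_natCard_mul_coeff_one`). To see this in a representation `ρ`, twist `ρ` by the tautological
character `G → K[T]`. The characters of `T` turn this into twists of `ρ` over `K`, which again have
spanning image, so the universal twist carries `H^*` to an adjugate over `K[T]`
(`blockMap_universalTwist_generalisedAdjoint`). The adjugate is a polynomial in the matrix with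
coefficients from the characteristic polynomial. Lifting from `O[T]` to the polynomial ring
`O[x_t : t ∈ T]`, which is integrally closed in `K[x_t : t ∈ T]`, shows that its entries come from
`O[T][G]` (`charpolyAdjoint_blockMap_monoidAlgebra`). Reading off the coefficient at one element of
`T`, the element `ρ(y)` lies in the image of `O[G]`, a finite `O`-algebra, hence is integral.
-/

open Polynomial
open scoped TensorProduct

noncomputable section

namespace DenominatorIdeal

/-! ### Left multiplication on matrix algebras -/

section LeftMultiplication

open scoped Kronecker in
/-- In the basis of matrix units, left multiplication by `M` has matrix `M ⊗ 1`. -/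
theorem charpoly_mulLeft_matrix {N R : Type*} [Fintype N] [DecidableEq N] [CommRing R]
    (M : Matrix N N R) :
    (LinearMap.mulLeft R M).charpoly = M.charpoly ^ Fintype.card N := by
  classical
  nontriviality R
  rw [← LinearMap.charpoly_toMatrix _ (Matrix.stdBasis R N N)]
  have h1 : LinearMap.toMatrix (Matrix.stdBasis R N N) (Matrix.stdBasis R N N)
      (LinearMap.mulLeft R M) = M ⊗ₖ (1 : Matrix N N R) := by
    ext ⟨i, j⟩ ⟨k, l⟩
    rw [LinearMap.toMatrix_apply, Matrix.stdBasis_eq_single, LinearMap.mulLeft_apply]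
    have : ∀ X : Matrix N N R, (Matrix.stdBasis R N N).repr X (i, j) = X i j := by
      intro X
      simp [Matrix.stdBasis, Module.Basis.repr_reindex]
    rw [this]
    simp [Matrix.mul_apply, Matrix.single_apply, Matrix.one_apply, ite_and, eq_comm]
  have h2 : (M ⊗ₖ (1 : Matrix N N R)).charmatrix = M.charmatrix ⊗ₖ (1 : Matrix N N R[X]) := by
    ext ⟨i, j⟩ ⟨k, l⟩
    by_cases hik : i = k <;> by_cases hjl : j = l <;>
      simp [hik, hjl]
  rw [h1, Matrix.charpoly, h2, Matrix.det_kronecker]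
  simp [Matrix.charpoly]

theorem monic_eq_of_pow_eq {E : Type*} [Field E] {p q : E[X]} (hp : p.Monic) (hq : q.Monic)
    {n : ℕ} (hn : n ≠ 0) (h : p ^ n = q ^ n) : p = q := by
  have h1 : p ∣ q := (IsIntegrallyClosed.pow_dvd_pow_iff hn).mp h.dvd
  have h2 : q ∣ p := (IsIntegrallyClosed.pow_dvd_pow_iff hn).mp h.symm.dvd
  exact eq_of_monic_of_associated hp hq (associated_of_dvd_dvd h1 h2)

end LeftMultiplication

/-! ### Splitting central simple algebras -/

section Splitting

variable {F E B C I : Type*} [Field F] [Field E] [Algebra F E] [Ring B] [Algebra F B]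
  [Ring C] [Algebra E C] [Algebra F C] [IsScalarTower F E C]

/-- A relation `∑ c_i β(b_i) = 0` with `F`-linearly independent scalars `c_i ∈ E` is trivial. By
induction on the support: if `b_{i₀} ≠ 0`, simplicity of `B` gives a relation with `b_{i₀} = 1`,
its commutators with `x ∈ B` are shorter relations, so all coefficients are central, hence in `F`,
contradicting the independence of the `c_i`. -/
theorem eq_zero_of_sum_smul_eq_zero [IsSimpleRing B] [Algebra.IsCentral F B] [Nontrivial C]
    (β : B →ₐ[F] C) {c : I → E} (hc : LinearIndependent F c) (s : Finset I) :
    ∀ b : I → B, ∑ i ∈ s, c i • β (b i) = 0 → ∀ i ∈ s, b i = 0 := by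
  classical
  induction s using Finset.induction with
  | empty => simp
  | insert i₀ s hi₀ ih =>
    intro b hb
    -- The values at `i₀` of the relations supported on `insert i₀ s` form a two-sided ideal.
    let J : TwoSidedIdeal B := TwoSidedIdeal.mk'
      {z | ∃ b : I → B, b i₀ = z ∧ ∑ i ∈ insert i₀ s, c i • β (b i) = 0}
      ⟨0, rfl, by simp⟩
      (by
        rintro _ _ ⟨b, rfl, hb⟩ ⟨b', rfl, hb'⟩
        exact ⟨b + b', rfl, by simp only [Pi.add_apply, map_add, smul_add,
          Finset.sum_add_distrib, hb, hb', add_zero]⟩)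
      (by
        rintro _ ⟨b, rfl, hb⟩
        exact ⟨-b, rfl, by simp only [Pi.neg_apply, map_neg, smul_neg,
          Finset.sum_neg_distrib, hb, neg_zero]⟩)
      (by
        rintro x _ ⟨b, rfl, hb⟩
        refine ⟨fun i => x * b i, rfl, ?_⟩
        simp only [map_mul, ← mul_smul_comm, ← Finset.mul_sum, hb, mul_zero])
      (by
        rintro _ x ⟨b, rfl, hb⟩
        refine ⟨fun i => b i * x, rfl, ?_⟩
        simp only [map_mul, ← smul_mul_assoc, ← Finset.sum_mul, hb, zero_mul])
    have hJ : ∀ z, z ∈ J ↔ ∃ b : I → B, b i₀ = z ∧ ∑ i ∈ insert i₀ s, c i • β (b i) = 0 :=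
      fun z => TwoSidedIdeal.mem_mk' _ _ _ _ _ _ z
    have hb0 : b i₀ = 0 := by
      by_contra hne
      obtain ⟨b', hb'1, hb'⟩ := (hJ 1).mp
        (IsSimpleRing.one_mem_of_ne_zero_mem J hne ((hJ _).mpr ⟨b, rfl, hb⟩))
      have hcomm : ∀ i ∈ s, ∀ x : B, x * b' i - b' i * x = 0 := by
        intro i hi x
        refine ih (fun i => x * b' i - b' i * x) ?_ i hi
        have e1 : ∑ i ∈ insert i₀ s, c i • β (x * b' i - b' i * x) = 0 := by
          simp only [map_sub, map_mul, smul_sub, Finset.sum_sub_distrib]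
          simp only [← mul_smul_comm, ← Finset.mul_sum, hb', mul_zero, zero_sub]
          simp only [mul_smul_comm, ← smul_mul_assoc, ← Finset.sum_mul, hb', zero_mul, neg_zero]
        rwa [Finset.sum_insert hi₀, hb'1, mul_one, one_mul, sub_self, map_zero, smul_zero,
          zero_add] at e1
      have hF : ∀ i ∈ insert i₀ s, ∃ f : F, algebraMap F B f = b' i := by
        intro i hi
        rcases Finset.mem_insert.mp hi with rfl | hi
        · exact ⟨1, by rw [map_one, hb'1]⟩
        · have : b' i ∈ Subalgebra.center F B :=
            Subalgebra.mem_center_iff.mpr fun x => sub_eq_zero.mp (hcomm i hi x)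
          exact Algebra.mem_bot.mp (Algebra.IsCentral.out this)
      choose! f hf using hF
      have e2 : ∑ i ∈ insert i₀ s, f i • c i = 0 := by
        apply FaithfulSMul.algebraMap_injective E C
        rw [map_zero, map_sum, ← hb']
        refine Finset.sum_congr rfl fun i hi => ?_
        rw [← hf i hi, AlgHom.commutes, Algebra.smul_def (f i), mul_comm, map_mul,
          ← IsScalarTower.algebraMap_apply, Algebra.smul_def]
      have e3 := linearIndependent_iff'.mp hc _ f e2 i₀ (Finset.mem_insert_self _ _)
      have e4 := hf i₀ (Finset.mem_insert_self _ _)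
      rw [e3, map_zero, hb'1] at e4
      exact zero_ne_one e4
    rw [Finset.sum_insert hi₀, hb0, map_zero, smul_zero, zero_add] at hb
    intro i hi
    rcases Finset.mem_insert.mp hi with rfl | hi
    · exact hb0
    · exact ih b hb i hi

/-- The `E`-algebra homomorphism `E ⊗ B → C`, `c ⊗ b ↦ c • β b`, extending an `F`-algebra
homomorphism `β : B → C` to an `E`-algebra `C`. -/
def scalarExtension (β : B →ₐ[F] C) : E ⊗[F] B →ₐ[E] C :=
  Algebra.TensorProduct.lift (Algebra.ofId E C) β fun _ _ => Algebra.commutes _ _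

theorem scalarExtension_tmul (β : B →ₐ[F] C) (c : E) (b : B) :
    scalarExtension β (c ⊗ₜ b) = c • β b := by
  rw [Algebra.smul_def]
  exact Algebra.TensorProduct.lift_tmul (Algebra.ofId E C) β
    (fun _ _ => Algebra.commutes _ _) c b

theorem scalarExtension_injective [IsSimpleRing B] [Algebra.IsCentral F B] [Nontrivial C]
    (β : B →ₐ[F] C) :
    Function.Injective (scalarExtension (E := E) β) := by
  classical
  rw [injective_iff_map_eq_zero]
  intro x hx
  obtain ⟨b, rfl⟩ := (TensorProduct.equivFinsuppOfBasisLeft (M := E) (N := B)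
    (Module.Basis.ofVectorSpace F E)).symm.surjective x
  have hb : b = 0 := by
    ext i
    by_contra hi
    refine hi (eq_zero_of_sum_smul_eq_zero β (Module.Basis.ofVectorSpace F E).linearIndependent
      b.support b ?_ i (Finsupp.mem_support_iff.mpr hi))
    rw [TensorProduct.equivFinsuppOfBasisLeft_symm_apply, Finsupp.sum, map_sum] at hx
    rw [← hx]
    refine Finset.sum_congr rfl fun i _ => ?_
    rw [scalarExtension_tmul]
  rw [hb, map_zero]

theorem scalarExtension_surjective (β : B →ₐ[F] C) (hβ : Submodule.span E (Set.range β) = ⊤) :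
    Function.Surjective (scalarExtension (E := E) β) := by
  intro x
  have hx : x ∈ Submodule.span E (Set.range β) := hβ ▸ Submodule.mem_top
  have hle : Submodule.span E (Set.range β) ≤
      LinearMap.range (scalarExtension (E := E) β).toLinearMap := by
    rw [Submodule.span_le]
    rintro _ ⟨b, rfl⟩
    exact ⟨1 ⊗ₜ b, (scalarExtension_tmul β 1 b).trans (one_smul _ _)⟩
  exact hle hx

/-- A homomorphism from a central simple `F`-algebra `B` to an `E`-algebra `C` whose image spans `C`
over `E` identifies `E ⊗ B` with `C`. -/
def splittingEquiv [IsSimpleRing B] [Algebra.IsCentral F B] [Nontrivial C]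
    (β : B →ₐ[F] C) (hβ : Submodule.span E (Set.range β) = ⊤) : E ⊗[F] B ≃ₐ[E] C :=
  AlgEquiv.ofBijective _ ⟨scalarExtension_injective β, scalarExtension_surjective β hβ⟩

theorem splittingEquiv_tmul [IsSimpleRing B] [Algebra.IsCentral F B] [Nontrivial C]
    (β : B →ₐ[F] C) (hβ : Submodule.span E (Set.range β) = ⊤) (b : B) :
    splittingEquiv β hβ (1 ⊗ₜ b) = β b :=
  (scalarExtension_tmul β 1 b).trans (one_smul _ _)

/-- The characteristic polynomial of a split form of `b`, raised to the degree of the algebra, is the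
characteristic polynomial of left multiplication by `b`, which is defined over `F`. -/
theorem charpoly_pow_eq_of_algEquiv {N : Type*} [Fintype N] [DecidableEq N]
    [FiniteDimensional F B] (φ : E ⊗[F] B ≃ₐ[E] Matrix N N E) (b : B) :
    (φ (1 ⊗ₜ b)).charpoly ^ Fintype.card N =
      (LinearMap.mulLeft F b).charpoly.map (algebraMap F E) := by
  rw [← charpoly_mulLeft_matrix, ← LinearMap.charpoly_baseChange,
    ← LinearEquiv.charpoly_conj φ.toLinearEquiv]
  congr 1
  ext1 x
  obtain ⟨y, rfl⟩ := φ.surjective x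
  rw [LinearMap.mulLeft_apply, ← map_mul, LinearEquiv.conj_apply_apply]
  change φ _ = φ _
  congr 1
  have hy : φ.toLinearEquiv.symm (φ y) = y := φ.symm_apply_apply y
  rw [hy]
  clear hy
  induction y using TensorProduct.induction_on with
  | zero => simp
  | tmul c z => simp
  | add y z hy hz => rw [mul_add, map_add, hy, hz]

theorem card_sq_eq_finrank {N : Type*} [Fintype N] [DecidableEq N]
    (φ : E ⊗[F] B ≃ₐ[E] Matrix N N E) : Fintype.card N ^ 2 = Module.finrank F B := by
  rw [← Module.finrank_baseChange (R := E), φ.toLinearEquiv.finrank_eq, Module.finrank_matrix]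
  simp [sq]

end Splitting

/-! ### The adjugate as a polynomial in the matrix -/

section CharpolyAdjoint

/-- The adjugate of a square matrix `M` of size `N`, written as the polynomial
`(-1) ^ (N + 1) * ∑_{1 ≤ j ≤ N} α_j M ^ (j - 1)` in `M`, where the `α_j` are the coefficients of
the characteristic polynomial of `M`. -/
def charpolyAdjoint {N R : Type*} [Fintype N] [DecidableEq N] [CommRing R] (M : Matrix N N R) :
    Matrix N N R :=
  (-1) ^ (Fintype.card N + 1) *
    ∑ j ∈ Finset.Icc 1 (Fintype.card N), M.charpoly.coeff j • M ^ (j - 1)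

theorem charpolyAdjoint_map {N R S : Type*} [Fintype N] [DecidableEq N] [CommRing R] [CommRing S]
    (f : R →+* S) (M : Matrix N N R) :
    (charpolyAdjoint M).map f = charpolyAdjoint (M.map f) := by
  have h : ∀ X : Matrix N N R, X.map f = f.mapMatrix X := fun _ => rfl
  rw [charpolyAdjoint, charpolyAdjoint, Matrix.charpoly_map, h, h]
  simp only [map_mul, map_pow, map_neg, map_one, map_sum, coeff_map]
  congr 1
  refine Finset.sum_congr rfl fun j _ => ?_
  rw [← map_pow]
  ext k l
  simp

end CharpolyAdjoint

/-! ### Reduced characteristic polynomials -/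

section ReducedCharpoly

variable {F E B N : Type*} [Field F] [Field E] [Algebra F E] [Ring B] [Algebra F B]
  [Fintype N] [DecidableEq N]

/-- A reduced characteristic polynomial is monic of degree `n`, where `n ^ 2 = dim_F B`, and its
`n`-th power is the characteristic polynomial of left multiplication. This determines it. -/
theorem IsReducedCharpoly.pow_eq [FiniteDimensional F B] {b : B} {f : F[X]}
    (h : IsReducedCharpoly F b f) {n : ℕ} (hn : n ^ 2 = Module.finrank F B) :
    f.Monic ∧ f.natDegree = n ∧ f ^ n = (LinearMap.mulLeft F b).charpoly := by
  obtain ⟨m, φ, h⟩ := h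
  have hm : m = n := by
    have := card_sq_eq_finrank φ
    rw [← hn, Fintype.card_fin] at this
    exact (Nat.pow_left_injective (n := 2) two_ne_zero) this
  have hinj := FaithfulSMul.algebraMap_injective F (AlgebraicClosure F)
  have hmon : f.Monic := by
    refine hinj.monic_map_iff.mpr ?_
    rw [← h]
    exact Matrix.charpoly_monic _
  refine ⟨hmon, ?_, ?_⟩
  · rw [← natDegree_map (algebraMap F (AlgebraicClosure F)), ← h, Matrix.charpoly_natDegree_eq_dim,
      Fintype.card_fin, hm]
  · have := charpoly_pow_eq_of_algEquiv φ b
    rw [h, Fintype.card_fin, hm, ← Polynomial.map_pow] at this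
    exact map_injective _ hinj this

/-- A split representation over any algebraic closure `E` of `F` gives one over the chosen one. -/
theorem exists_algHom_algebraicClosure [IsAlgClosure F E] (β : B →ₐ[F] Matrix N N E)
    (hβ : Submodule.span E (Set.range β) = ⊤) :
    ∃ β' : B →ₐ[F] Matrix (Fin (Fintype.card N)) (Fin (Fintype.card N)) (AlgebraicClosure F),
      Submodule.span (AlgebraicClosure F) (Set.range β') = ⊤ := by
  let e : E ≃ₐ[F] AlgebraicClosure F := IsAlgClosure.equiv F E (AlgebraicClosure F)
  let r : Matrix N N E ≃ₐ[F] Matrix (Fin (Fintype.card N)) (Fin (Fintype.card N))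
      (AlgebraicClosure F) :=
    e.mapMatrix.trans (Matrix.reindexAlgEquiv F _ (Fintype.equivFin N))
  have hr : ∀ (c : E) (X : Matrix N N E), r (c • X) = e c • r X := by
    intro c X
    ext i j
    simp [r]
  refine ⟨r.toAlgHom.comp β, ?_⟩
  rw [eq_top_iff]
  rintro Y -
  obtain ⟨X, rfl⟩ := r.surjective Y
  have hX : X ∈ Submodule.span E (Set.range β) := hβ ▸ Submodule.mem_top
  induction hX using Submodule.span_induction with
  | mem x hx =>
    obtain ⟨b, rfl⟩ := hx
    exact Submodule.subset_span ⟨b, rfl⟩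
  | zero => rw [map_zero]; exact Submodule.zero_mem _
  | add x y _ _ hx hy => rw [map_add]; exact Submodule.add_mem _ hx hy
  | smul c x _ hx => rw [hr]; exact Submodule.smul_mem _ _ hx

theorem isReducedCharpoly_reducedCharpoly {b : B} (h : ∃ f, IsReducedCharpoly F b f) :
    IsReducedCharpoly F b (reducedCharpoly F b) := by
  rw [reducedCharpoly, dif_pos h]
  exact h.choose_spec

variable [IsSimpleRing B] [Algebra.IsCentral F B] [FiniteDimensional F B] [Nonempty N]

/-- The characteristic polynomial of `β b` descends to `F`: it is monic and one of its powers has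
coefficients in `F`, so it is fixed by the Galois group. -/
theorem exists_isReducedCharpoly [CharZero F] {n : ℕ} [NeZero n]
    (β : B →ₐ[F] Matrix (Fin n) (Fin n) (AlgebraicClosure F))
    (hβ : Submodule.span (AlgebraicClosure F) (Set.range β) = ⊤) (b : B) :
    ∃ f, IsReducedCharpoly F b f := by
  have hpow := charpoly_pow_eq_of_algEquiv (splittingEquiv β hβ) b
  rw [splittingEquiv_tmul, Fintype.card_fin] at hpow
  have hlift : (β b).charpoly ∈ lifts (algebraMap F (AlgebraicClosure F)) := by
    rw [lifts_iff_coeff_lifts]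
    intro k
    rw [InfiniteGalois.mem_range_algebraMap_iff_fixed]
    intro τ
    have hτ : (β b).charpoly.map (τ : AlgebraicClosure F →+* AlgebraicClosure F) =
        (β b).charpoly := by
      refine monic_eq_of_pow_eq ((Matrix.charpoly_monic _).map _) (Matrix.charpoly_monic _)
        (NeZero.ne n) ?_
      rw [← Polynomial.map_pow, hpow, Polynomial.map_map]
      congr 1
      ext x
      simp
    conv_rhs => rw [← hτ]
    simp
  obtain ⟨f, hf⟩ := (mem_lifts _).mp hlift
  exact ⟨f, n, splittingEquiv β hβ, by rw [splittingEquiv_tmul, hf]⟩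

/-- A homomorphism from a central simple algebra to a matrix algebra over an algebraic closure, with
spanning image, carries generalised adjoints to adjugates. -/
theorem map_simpleAdjoint [CharZero F] [IsAlgClosure F E] (β : B →ₐ[F] Matrix N N E)
    (hβ : Submodule.span E (Set.range β) = ⊤) (b : B) :
    β (simpleAdjoint F b) = charpolyAdjoint (β b) := by
  obtain ⟨β', hβ'⟩ := exists_algHom_algebraicClosure β hβ
  have : NeZero (Fintype.card N) := ⟨Fintype.card_ne_zero⟩
  obtain ⟨hmon, hdeg, hpow⟩ := (isReducedCharpoly_reducedCharpoly
    (exists_isReducedCharpoly β' hβ' b)).pow_eq (card_sq_eq_finrank (splittingEquiv β hβ))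
  have hpow' := charpoly_pow_eq_of_algEquiv (splittingEquiv β hβ) b
  rw [splittingEquiv_tmul, ← hpow, Polynomial.map_pow] at hpow'
  have hchar : (β b).charpoly = (reducedCharpoly F b).map (algebraMap F E) :=
    monic_eq_of_pow_eq (Matrix.charpoly_monic _) (hmon.map _) Fintype.card_ne_zero hpow'
  rw [simpleAdjoint, charpolyAdjoint, hdeg, hchar]
  simp only [map_mul, map_pow, map_neg, map_one, map_sum, map_smul, coeff_map, algebraMap_smul]

end ReducedCharpoly

/-! ### Components of semisimple rings -/

section Semisimple

variable {A : Type*} [Ring A] [IsSemisimpleRing A]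

/-- A two-sided ideal of a semisimple ring is generated by a central idempotent. -/
theorem exists_central_idempotent_span (J : Ideal A) [J.IsTwoSided] :
    ∃ f : A, IsIdempotentElem f ∧ f ∈ Subring.center A ∧ J = Ideal.span {f} := by
  obtain ⟨f, hf, hJ⟩ := IsSemisimpleRing.ideal_eq_span_idempotent J
  have hfJ : f ∈ J := hJ ▸ Ideal.mem_span_singleton_self f
  have hmul : ∀ x ∈ J, x * f = x := by
    intro x hx
    rw [hJ] at hx
    obtain ⟨a, rfl⟩ := Ideal.mem_span_singleton'.mp hx
    rw [mul_assoc, hf.eq]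
  refine ⟨f, hf, Subring.mem_center_iff.mpr fun a => ?_, hJ⟩
  have h1 : f * a * f = f * a := hmul _ (J.mul_mem_right a hfJ)
  -- `y` satisfies `y A y = 0`, so it vanishes, as `A` is semisimple.
  set y := a * f - f * a * f with hy
  have hyJ : y ∈ J := J.sub_mem (J.mul_mem_left _ hfJ) (J.mul_mem_left _ hfJ)
  have hfy : f * y = 0 := by
    rw [hy, mul_sub, ← mul_assoc, ← mul_assoc, ← mul_assoc, hf.eq, sub_self]
  have hyy : ∀ b, y * b * y = 0 := by
    intro b
    rw [← hmul (y * b) (J.mul_mem_right b hyJ), mul_assoc, hfy, mul_zero]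
  obtain ⟨g, hg, hspan⟩ := IsSemisimpleRing.ideal_eq_span_idempotent (Ideal.span {y})
  obtain ⟨c, hc⟩ := Ideal.mem_span_singleton'.mp
    (hspan ▸ Ideal.mem_span_singleton_self g : g ∈ Ideal.span {y})
  obtain ⟨d, hd⟩ := Ideal.mem_span_singleton'.mp
    (hspan ▸ Ideal.mem_span_singleton_self y : y ∈ Ideal.span {g})
  have hg0 : g = 0 := by
    rw [← hg.eq, ← hc, mul_assoc, ← mul_assoc y, hyy, mul_zero]
  have hy0 : y = 0 := by rw [← hd, hg0, mul_zero]
  rw [← h1]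
  exact sub_eq_zero.mp hy0

end Semisimple

namespace CentralPrimitiveIdempotent

section Orthogonality

variable {A : Type*} [Ring A]

theorem ext_e {ε ε' : CentralPrimitiveIdempotent A} (h : ε.e = ε'.e) : ε = ε' := by
  cases ε
  cases ε'
  cases h
  rfl

theorem mul_eq_zero {ε ε' : CentralPrimitiveIdempotent A} (h : ε ≠ ε') : ε.e * ε'.e = 0 := by
  have hc : ε.e * ε'.e = ε'.e * ε.e := Subring.mem_center_iff.mp ε'.central ε.e
  have hidem : IsIdempotentElem (ε.e * ε'.e) := IsIdempotentElem.mul_of_commute hc ε.idem ε'.idem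
  have hcent : ε.e * ε'.e ∈ Subring.center A := Subring.mul_mem _ ε.central ε'.central
  have h1 := ε.primitive _ hidem hcent (by rw [hc, mul_assoc, ε.idem.eq])
  have h2 := ε'.primitive _ hidem hcent (by rw [mul_assoc, ε'.idem.eq])
  rcases h1 with h1 | h1
  · exact h1
  · rcases h2 with h2 | h2
    · exact h2
    · exact absurd (ext_e (h1.symm.trans h2)) h

theorem finite [Algebra ℚ A] [FiniteDimensional ℚ A] : Finite (CentralPrimitiveIdempotent A) := by
  classical
  have hli : LinearIndependent ℚ (fun ε : CentralPrimitiveIdempotent A => ε.e) := by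
    rw [linearIndependent_iff']
    intro s c hc ε hε
    have h := congrArg (· * ε.e) hc
    simp only [Finset.sum_mul, smul_mul_assoc, zero_mul] at h
    rw [Finset.sum_eq_single ε, ε.idem.eq] at h
    · exact (smul_eq_zero.mp h).resolve_right ε.ne_zero
    · intro ε' _ hne
      rw [mul_eq_zero hne, smul_zero]
    · exact fun h => absurd hε h
  exact hli.finite

theorem e_mul_val (ε : CentralPrimitiveIdempotent A) (x : ε.Component) : ε.e * x.val = x.val :=
  ((Subsemigroup.mem_corner_iff ε.idem).mp x.2).1

theorem proj_val (ε : CentralPrimitiveIdempotent A) (x : ε.Component) : ε.proj x.val = x := by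
  have h := (Subsemigroup.mem_corner_iff ε.idem).mp x.2
  exact Subtype.ext ((congrArg (· * ε.e) h.1).trans h.2)

theorem proj_val_eq (ε : CentralPrimitiveIdempotent A) (a : A) : (ε.proj a).val = ε.e * a := by
  change ε.e * a * ε.e = _
  rw [mul_assoc, Subring.mem_center_iff.mp ε.central a, ← mul_assoc, ε.idem.eq]

theorem proj_add (ε : CentralPrimitiveIdempotent A) (a b : A) :
    ε.proj (a + b) = ε.proj a + ε.proj b := by
  refine Subtype.ext ?_
  change _ = (ε.proj a).val + (ε.proj b).val
  rw [proj_val_eq, proj_val_eq, proj_val_eq, mul_add]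

instance component_isCentral [IsSemisimpleRing A] (ε : CentralPrimitiveIdempotent A) :
    Algebra.IsCentral (Subring.center ε.Component) ε.Component where
  out x hx := Algebra.mem_bot.mpr
    ⟨⟨x, Subring.mem_center_iff.mpr (Subalgebra.mem_center_iff.mp hx)⟩, rfl⟩

instance component_isSimpleRing [IsSemisimpleRing A] (ε : CentralPrimitiveIdempotent A) :
    IsSimpleRing ε.Component := by
  rw [isSimpleRing_iff_isTwoSided_imp]
  refine ⟨⟨1, 0, fun h => ε.ne_zero (congrArg Subtype.val h)⟩, fun I hI => ?_⟩
  let J : Ideal A :=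
    { carrier := {a | ∃ x ∈ I, x.val = a}
      zero_mem' := ⟨0, I.zero_mem, rfl⟩
      add_mem' := by
        rintro _ _ ⟨x, hx, rfl⟩ ⟨y, hy, rfl⟩
        exact ⟨x + y, I.add_mem hx hy, rfl⟩
      smul_mem' := by
        rintro a _ ⟨x, hx, rfl⟩
        refine ⟨ε.proj a * x, I.mul_mem_left _ hx, ?_⟩
        change (ε.proj a).val * x.val = a * x.val
        rw [proj_val_eq, ← Subring.mem_center_iff.mp ε.central a, mul_assoc, e_mul_val] }
  have hJ : J.IsTwoSided := ⟨by
    rintro _ b ⟨x, hx, rfl⟩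
    refine ⟨x * ε.proj b, I.mul_mem_right _ hx, ?_⟩
    change x.val * (ε.proj b).val = x.val * b
    rw [proj_val_eq, ← mul_assoc, Subring.mem_center_iff.mp ε.central, e_mul_val]⟩
  obtain ⟨f, hf, hfc, hspan⟩ := exists_central_idempotent_span J
  obtain ⟨x, hxI, hxf⟩ : f ∈ J := hspan ▸ Ideal.mem_span_singleton_self f
  rcases ε.primitive f hf hfc (by rw [Subring.mem_center_iff.mp ε.central, ← hxf, e_mul_val])
    with h | h
  · left
    rw [eq_bot_iff]
    intro y hy
    have : y.val ∈ J := ⟨y, hy, rfl⟩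
    rw [hspan, h, Ideal.span_singleton_eq_bot.mpr rfl] at this
    exact Subtype.ext this
  · right
    rw [Ideal.eq_top_iff_one]
    have : x = 1 := Subtype.ext (hxf.trans h)
    exact this ▸ hxI

end Orthogonality

end CentralPrimitiveIdempotent

/-! ### Matrix representations with spanning image -/

section SplitRepresentation

variable {K D A : Type*} [Field K] [Fintype D] [DecidableEq D] [Ring A]

/-- Schur's lemma for a representation whose image spans the matrix algebra. -/
theorem exists_scalar_of_commute {ψ : A →+* Matrix D D K}
    (hψ : Submodule.span K (Set.range ψ) = ⊤) {X : Matrix D D K}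
    (hX : ∀ a, ψ a * X = X * ψ a) : ∃ c : K, algebraMap K (Matrix D D K) c = X := by
  have : X ∈ Subalgebra.center K (Matrix D D K) := by
    rw [Subalgebra.mem_center_iff]
    intro Y
    have hY : Y ∈ Submodule.span K (Set.range ψ) := hψ ▸ Submodule.mem_top
    induction hY using Submodule.span_induction with
    | mem x hx =>
      obtain ⟨a, rfl⟩ := hx
      exact hX a
    | zero => rw [zero_mul, mul_zero]
    | add x y _ _ hx hy => rw [add_mul, mul_add, hx, hy]
    | smul c x _ hx => rw [smul_mul_assoc, mul_smul_comm, hx]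
  exact Algebra.mem_bot.mp (Algebra.IsCentral.out this)

theorem map_central_idempotent {ψ : A →+* Matrix D D K}
    (hψ : Submodule.span K (Set.range ψ) = ⊤) {f : A} (hf : IsIdempotentElem f)
    (hc : f ∈ Subring.center A) : ψ f = 0 ∨ ψ f = 1 := by
  obtain ⟨c, hc⟩ := exists_scalar_of_commute hψ (X := ψ f) fun a => by
    rw [← map_mul, ← map_mul, Subring.mem_center_iff.mp hc]
  rcases isEmpty_or_nonempty D with hD | hD
  · exact Or.inl (Subsingleton.elim _ _)
  have hcc : c * c = c := by
    apply FaithfulSMul.algebraMap_injective K (Matrix D D K)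
    rw [map_mul, hc, ← map_mul, hf.eq]
  rcases (IsIdempotentElem.iff_eq_zero_or_one).mp hcc with rfl | rfl
  · left; rw [← hc, map_zero]
  · right; rw [← hc, map_one]

variable [Nonempty D] [Algebra ℚ A] [FiniteDimensional ℚ A]

/-- A matrix representation with spanning image factors through exactly one component. -/
theorem exists_map_eq_one {ψ : A →+* Matrix D D K}
    (hψ : Submodule.span K (Set.range ψ) = ⊤) :
    ∃ ε : CentralPrimitiveIdempotent A, ψ ε.e = 1 ∧ ∀ ε', ε' ≠ ε → ψ ε'.e = 0 := by
  classical
  -- A central idempotent not killed by `ψ` that generates an ideal of least dimension.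
  let P : ℕ → Prop := fun r => ∃ f : A, IsIdempotentElem f ∧ f ∈ Subring.center A ∧ ψ f = 1 ∧
    Module.finrank ℚ (LinearMap.range (LinearMap.mulLeft ℚ f)) = r
  have hP : ∃ r, P r := ⟨_, 1, IsIdempotentElem.one, Subring.one_mem _, map_one ψ, rfl⟩
  obtain ⟨f, hf, hfc, hf1, hr⟩ := Nat.find_spec hP
  have hmin : ∀ g : A, IsIdempotentElem g → g ∈ Subring.center A → ψ g = 1 → g * f = g →
      g = f := by
    intro g hg hgc hg1 hgf
    have hle : LinearMap.range (LinearMap.mulLeft ℚ g) ≤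
        LinearMap.range (LinearMap.mulLeft ℚ f) := by
      rintro _ ⟨a, rfl⟩
      refine ⟨g * a, ?_⟩
      rw [LinearMap.mulLeft_apply, LinearMap.mulLeft_apply, ← mul_assoc,
        Subring.mem_center_iff.mp hgc, hgf]
    have heq := Submodule.eq_of_le_of_finrank_le hle
      (hr ▸ Nat.find_min' hP ⟨g, hg, hgc, hg1, rfl⟩)
    obtain ⟨a, ha⟩ : f ∈ LinearMap.range (LinearMap.mulLeft ℚ g) := by
      rw [heq]
      exact ⟨1, by simp⟩
    rw [LinearMap.mulLeft_apply] at ha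
    rw [← hgf]
    conv_lhs => rw [← ha, ← mul_assoc, hg.eq, ha]
  refine ⟨⟨f, hf, hfc, ?_, ?_⟩, hf1, ?_⟩
  · rintro rfl
    rw [map_zero, eq_comm] at hf1
    exact one_ne_zero hf1
  · intro g hg hgc hgf
    have hfg : f * g = g := by rw [Subring.mem_center_iff.mp hgc, hgf]
    rcases map_central_idempotent hψ hg hgc with h | h
    · left
      have h' := hmin (f - g)
        (by
          change (f - g) * (f - g) = f - g
          rw [mul_sub, sub_mul, sub_mul, hf.eq, hgf, hfg, hg.eq, sub_self, sub_zero])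
        (Subring.sub_mem _ hfc hgc) (by rw [map_sub, h, hf1, sub_zero])
        (by rw [sub_mul, hf.eq, hgf])
      exact sub_eq_self.mp h'
    · exact Or.inr (hmin g hg hgc h hgf)
  · intro ε' hε'
    have h : ψ (ε'.e * f) = 0 :=
      (congrArg ψ (CentralPrimitiveIdempotent.mul_eq_zero hε')).trans (map_zero ψ)
    rwa [map_mul, hf1, mul_one] at h

end SplitRepresentation

/-! ### The generalised adjoint under matrix representations -/

section Blocks

variable {K D A I : Type*} [Field K] [Fintype D] [DecidableEq D] [Ring A] [Fintype I]
  [DecidableEq I]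

/-- The ring homomorphism `M_I(A) → M_{I × D}(R)` that applies a matrix representation
`ψ : A → M_D(R)` to each entry. -/
def blockMap {R : Type*} [CommRing R] (I : Type*) [Fintype I] [DecidableEq I]
    (ψ : A →+* Matrix D D R) : Matrix I I A →+* Matrix (I × D) (I × D) R :=
  (Matrix.compRingEquiv I D R).toRingHom.comp ψ.mapMatrix

theorem blockMap_apply {R : Type*} [CommRing R] (ψ : A →+* Matrix D D R) (H : Matrix I I A)
    (i j : I) (k l : D) : blockMap I ψ H (i, k) (j, l) = ψ (H i j) k l := rfl

theorem span_range_blockMap {ψ : A →+* Matrix D D K}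
    (hψ : Submodule.span K (Set.range ψ) = ⊤) :
    Submodule.span K (Set.range (blockMap I ψ)) = ⊤ := by
  rw [eq_top_iff]
  rintro X -
  obtain ⟨Y, rfl⟩ := (Matrix.compAlgEquiv I D K K).surjective X
  rw [Matrix.matrix_eq_sum_single Y, map_sum]
  refine Submodule.sum_mem _ fun i _ => ?_
  rw [map_sum]
  refine Submodule.sum_mem _ fun j _ => ?_
  have hY : Y i j ∈ Submodule.span K (Set.range ψ) := hψ ▸ Submodule.mem_top
  generalize Y i j = Z at hY
  induction hY using Submodule.span_induction with
  | mem x hx =>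
    obtain ⟨a, rfl⟩ := hx
    refine Submodule.subset_span ⟨Matrix.single i j a, ?_⟩
    ext ⟨i', k⟩ ⟨j', l⟩
    rw [blockMap_apply, Matrix.compAlgEquiv_apply, Matrix.comp_apply]
    simp only [Matrix.single_apply]
    split_ifs <;> simp
  | zero => rw [Matrix.single_zero, map_zero]; exact Submodule.zero_mem _
  | add x y _ _ hx hy => rw [Matrix.single_add, map_add]; exact Submodule.add_mem _ hx hy
  | smul c x _ hx =>
    rw [← Matrix.smul_single, map_smul]; exact Submodule.smul_mem _ _ hx

end Blocks

namespace CentralPrimitiveIdempotent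

section Restrict

variable {K D A : Type*} [Field K] [Fintype D] [DecidableEq D] [Ring A]

/-- A matrix representation of `A` that is `1` on the central idempotent `ε.e` restricts to the
component of `ε`. -/
def restrict (ε : CentralPrimitiveIdempotent A) (ψ : A →+* Matrix D D K) (h : ψ ε.e = 1) :
    ε.Component →+* Matrix D D K where
  toFun x := ψ x.val
  map_one' := h
  map_mul' x y := map_mul ψ x.val y.val
  map_zero' := map_zero ψ
  map_add' x y := map_add ψ x.val y.val

theorem restrict_apply (ε : CentralPrimitiveIdempotent A) (ψ : A →+* Matrix D D K)
    (h : ψ ε.e = 1) (x : ε.Component) : ε.restrict ψ h x = ψ x.val := rfl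

theorem restrict_proj (ε : CentralPrimitiveIdempotent A) (ψ : A →+* Matrix D D K)
    (h : ψ ε.e = 1) (a : A) : ε.restrict ψ h (ε.proj a) = ψ a := by
  rw [restrict_apply, proj_val_eq, map_mul, h, one_mul]

theorem range_restrict (ε : CentralPrimitiveIdempotent A) (ψ : A →+* Matrix D D K)
    (h : ψ ε.e = 1) : Set.range (ε.restrict ψ h) = Set.range ψ := by
  ext X
  constructor
  · rintro ⟨x, rfl⟩
    exact ⟨x.val, rfl⟩
  · rintro ⟨a, rfl⟩
    exact ⟨ε.proj a, restrict_proj ε ψ h a⟩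

end Restrict

variable {K D A : Type*} [Field K] [Fintype D] [DecidableEq D] [Ring A] [IsSemisimpleRing A]
  [Nonempty D]

/-- The centre of a component acts by scalars in a representation with spanning image. -/
theorem exists_centralCharacter (ε : CentralPrimitiveIdempotent A) {ψ : A →+* Matrix D D K}
    (hψ : Submodule.span K (Set.range ψ) = ⊤) (h : ψ ε.e = 1) :
    ∃ σ : Subring.center ε.Component →+* K,
      ∀ z, algebraMap K (Matrix D D K) (σ z) = ε.restrict ψ h z := by
  have hz : ∀ z : Subring.center ε.Component,
      ∃ c : K, algebraMap K (Matrix D D K) c = ε.restrict ψ h z := fun z =>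
    exists_scalar_of_commute (ψ := ε.restrict ψ h) (by rwa [range_restrict]) fun a => by
      rw [← map_mul, ← map_mul, Subring.mem_center_iff.mp z.2]
  choose σ hσ using hz
  have hinj := FaithfulSMul.algebraMap_injective K (Matrix D D K)
  exact ⟨{ toFun := σ
           map_one' := hinj (by rw [hσ, map_one]; exact map_one _)
           map_zero' := hinj (by rw [hσ, map_zero]; exact map_zero _)
           map_mul' := fun x y => hinj (by
            rw [hσ, map_mul, hσ, hσ]; exact map_mul _ _ _)
           map_add' := fun x y => hinj (by
            rw [hσ, map_add, hσ, hσ]; exact map_add _ _ _) }, hσ⟩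

theorem finite_component [Algebra ℚ A] [FiniteDimensional ℚ A]
    (ε : CentralPrimitiveIdempotent A) [CharZero (Subring.center ε.Component)] :
    FiniteDimensional (Subring.center ε.Component) ε.Component := by
  let : Module ℚ ε.Component :=
    Module.compHom ε.Component (algebraMap ℚ (Subring.center ε.Component))
  have : IsScalarTower ℚ (Subring.center ε.Component) ε.Component :=
    ⟨fun q z x => by
      change (q • z) • x = algebraMap ℚ (Subring.center ε.Component) q • (z • x)
      rw [Algebra.smul_def q z]
      exact mul_smul _ _ _⟩
  let p : A →+ ε.Component := AddMonoidHom.mk' ε.proj ε.proj_add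
  have : FiniteDimensional ℚ ε.Component :=
    Module.Finite.of_surjective p.toRatLinearMap fun x => ⟨x.val, proj_val ε x⟩
  exact Module.Finite.of_restrictScalars_finite ℚ _ _

theorem map_simpleAdjoint_proj [CharZero K] [IsAlgClosure ℚ K] [Algebra ℚ A] [FiniteDimensional ℚ A]
    (ε : CentralPrimitiveIdempotent A) {ψ : A →+* Matrix D D K}
    (hψ : Submodule.span K (Set.range ψ) = ⊤) (h : ψ ε.e = 1) {n : ℕ} [NeZero n]
    (H : Matrix (Fin n) (Fin n) A) :
    blockMap (Fin n) ψ
      ((simpleAdjoint (Subring.center ε.Component) (H.map ε.proj)).map Subtype.val) =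
        charpolyAdjoint (blockMap (Fin n) ψ H) := by
  obtain ⟨σ, hσ⟩ := ε.exists_centralCharacter hψ h
  let : Algebra (Subring.center ε.Component) K := σ.toAlgebra
  have : CharZero (Subring.center ε.Component) := σ.charZero
  have := ε.finite_component
  have : IsAlgClosure (Subring.center ε.Component) K :=
    { isAlgClosed := IsAlgClosure.isAlgClosed ℚ
      isAlgebraic := by
        have := IsAlgClosure.isAlgebraic (R := ℚ) (K := K)
        exact Algebra.IsAlgebraic.tower_top (K := ℚ) _ }
  let β : Matrix (Fin n) (Fin n) ε.Component →ₐ[Subring.center ε.Component]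
      Matrix (Fin n × D) (Fin n × D) K :=
    { blockMap (Fin n) (ε.restrict ψ h) with
      commutes' := fun z => by
        ext ⟨i, k⟩ ⟨j, l⟩
        change ε.restrict ψ h (algebraMap _ (Matrix (Fin n) (Fin n) ε.Component) z i j) k l =
          algebraMap _ (Matrix (Fin n × D) (Fin n × D) K) z (i, k) (j, l)
        rw [Matrix.algebraMap_matrix_apply, Matrix.algebraMap_matrix_apply]
        by_cases hij : i = j
        · rw [if_pos hij]
          refine (congrFun (congrFun (hσ z) k) l).symm.trans ?_
          rw [Matrix.algebraMap_matrix_apply]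
          simp only [Prod.mk.injEq, hij, true_and]
          rfl
        · rw [if_neg hij, if_neg fun h => hij (congrArg Prod.fst h), map_zero]
          rfl }
  have hβ : Submodule.span K (Set.range β) = ⊤ :=
    span_range_blockMap (by rwa [range_restrict])
  have key := map_simpleAdjoint β hβ (H.map ε.proj)
  have e1 : β (H.map ε.proj) = blockMap (Fin n) ψ H := by
    ext ⟨i, k⟩ ⟨j, l⟩
    exact congrFun (congrFun (restrict_proj ε ψ h (H i j)) k) l
  rw [e1] at key
  exact key

end CentralPrimitiveIdempotent

/-- A matrix representation of `A` over an algebraic closure of `ℚ`, with spanning image, carries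
the generalised adjoint of a matrix to the adjugate of its image. -/
theorem blockMap_generalisedAdjoint {K D A : Type*} [Field K] [CharZero K] [IsAlgClosure ℚ K]
    [Fintype D] [DecidableEq D] [Nonempty D] [Ring A] [IsSemisimpleRing A] [Algebra ℚ A]
    [FiniteDimensional ℚ A]
    {ψ : A →+* Matrix D D K} (hψ : Submodule.span K (Set.range ψ) = ⊤) {n : ℕ}
    (H : Matrix (Fin n) (Fin n) A) :
    blockMap (Fin n) ψ (generalisedAdjoint H) = charpolyAdjoint (blockMap (Fin n) ψ H) := by
  -- For `n = 0` the matrix algebra is zero, so not simple, but there are no entries to compare.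
  rcases Nat.eq_zero_or_pos n with rfl | hn
  · ext ⟨i, _⟩
    exact i.elim0
  have : NeZero n := ⟨hn.ne'⟩
  obtain ⟨ε, hε, hother⟩ := exists_map_eq_one hψ
  have := CentralPrimitiveIdempotent.finite (A := A)
  rw [generalisedAdjoint, ← ε.map_simpleAdjoint_proj hψ hε H]
  have := Fintype.ofFinite (CentralPrimitiveIdempotent A)
  rw [finsum_eq_sum_of_fintype, map_sum, Finset.sum_eq_single ε]
  · intro ε' _ hne
    ext ⟨i, k⟩ ⟨j, l⟩
    have hx : ∀ x : ε'.Component, ψ x.val = 0 := fun x => by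
      rw [← ε'.e_mul_val, map_mul, hother ε' hne, zero_mul]
    exact congrFun (congrFun (hx _) k) l
  · exact fun h => absurd (Finset.mem_univ ε) h

/-! ### The generalised adjoint of the zero element of `ℚ[G]` -/

section CharpolyAdjointSpecialValues

variable {N R : Type*} [Fintype N] [DecidableEq N] [CommRing R]

theorem charpolyAdjoint_eq_one (h : Fintype.card N = 1) (M : Matrix N N R) :
    charpolyAdjoint M = 1 := by
  nontriviality R
  have h1 : M.charpoly.coeff 1 = 1 := by
    have := (Matrix.charpoly_monic M).coeff_natDegree
    rwa [Matrix.charpoly_natDegree_eq_dim, h] at this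
  rw [charpolyAdjoint, h, Finset.Icc_self, Finset.sum_singleton, h1]
  simp

theorem charpolyAdjoint_zero (h : Fintype.card N ≠ 1) :
    charpolyAdjoint (0 : Matrix N N R) = 0 := by
  rw [charpolyAdjoint, Finset.sum_eq_zero, mul_zero]
  intro j hj
  rw [Matrix.charpoly_zero, coeff_X_pow]
  split_ifs with hjN
  · have := (Finset.mem_Icc.mp hj).1
    rw [zero_pow (by omega), smul_zero]
  · rw [zero_smul]

end CharpolyAdjointSpecialValues

section Group

variable {K : Type*} [Field K] {G : Type*} [Group G]

theorem span_range_of_surjective {D : Type*} [Fintype D] [DecidableEq D]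
    {ψ : MonoidAlgebra K G →ₐ[K] Matrix D D K} (hψ : Function.Surjective ψ) :
    Submodule.span K (Set.range fun g : G => ψ (MonoidAlgebra.single g 1)) = ⊤ := by
  rw [eq_top_iff]
  rintro X -
  obtain ⟨x, rfl⟩ := hψ X
  induction x using MonoidAlgebra.induction_linear with
  | zero => rw [map_zero]; exact Submodule.zero_mem _
  | add x y hx hy => rw [map_add]; exact Submodule.add_mem _ hx hy
  | single g c =>
    have : MonoidAlgebra.single g c = c • (MonoidAlgebra.single g 1 : MonoidAlgebra K G) := by
      rw [MonoidAlgebra.smul_single, smul_eq_mul, mul_one]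
    rw [this, map_smul]
    exact Submodule.smul_mem _ _ (Submodule.subset_span ⟨g, rfl⟩)

variable [CharZero K]

theorem map_eq_one_of_mem_commutator {M : Type*} [Monoid M] (f : G →* M)
    (hf : ∀ a b, f a * f b = f b * f a) {g : G} (hg : g ∈ commutator G) : f g = 1 := by
  have hle : commutator G ≤ f.toHomUnits.ker := by
    rw [commutator_def, Subgroup.commutator_le]
    intro a _ b _
    rw [MonoidHom.mem_ker, map_commutatorElement, commutatorElement_eq_one_iff_mul_comm]
    exact Units.ext (hf a b)
  exact congrArg Units.val (MonoidHom.mem_ker.mp (hle hg))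

/-- The surjective matrix representations of `K[G]` separate its elements. -/
theorem eq_zero_of_forall_map_eq_zero [Finite G] [IsAlgClosed K] {a : MonoidAlgebra K G}
    (h : ∀ (d : ℕ) (_ : NeZero d) (ψ : MonoidAlgebra K G →ₐ[K] Matrix (Fin d) (Fin d) K),
      Function.Surjective ψ → ψ a = 0) : a = 0 := by
  obtain ⟨m, d, hd, ⟨Ψ⟩⟩ :=
    IsSemisimpleRing.exists_algEquiv_pi_matrix_of_isAlgClosed K (MonoidAlgebra K G)
  apply Ψ.injective
  rw [map_zero]
  funext k
  refine h (d k) (hd k) ((Pi.evalAlgHom K _ k).comp Ψ.toAlgHom) ?_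
  exact (Function.surjective_eval k).comp Ψ.surjective

theorem eq_zero_of_forall_character_eq_zero [IsAlgClosed K] {T : Type*} [CommGroup T] [Finite T]
    {a : MonoidAlgebra K T} (h : ∀ χ : MonoidAlgebra K T →ₐ[K] K, χ a = 0) : a = 0 := by
  refine eq_zero_of_forall_map_eq_zero fun d _ ψ hψ => ?_
  -- The image of `ψ` is a commutative full matrix algebra, so consists of scalars.
  have hbij : Function.Bijective (Algebra.ofId K (Matrix (Fin d) (Fin d) K)) := by
    refine ⟨FaithfulSMul.algebraMap_injective K _, fun X => ?_⟩
    have hX : X ∈ Subalgebra.center K (Matrix (Fin d) (Fin d) K) := by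
      rw [Subalgebra.mem_center_iff]
      intro Y
      obtain ⟨x, rfl⟩ := hψ X
      obtain ⟨y, rfl⟩ := hψ Y
      rw [← map_mul, ← map_mul, mul_comm]
    exact Algebra.mem_bot.mp (Algebra.IsCentral.out hX)
  let e := AlgEquiv.ofBijective _ hbij
  apply e.symm.injective
  rw [map_zero]
  exact h (e.symm.toAlgHom.comp ψ)

/-- The restriction to `ℚ[G]` of a matrix representation of `K[G]`. -/
def rationalRestriction {D : Type*} [Fintype D] [DecidableEq D]
    (ψ : MonoidAlgebra K G →ₐ[K] Matrix D D K) : MonoidAlgebra ℚ G →+* Matrix D D K :=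
  ψ.toRingHom.comp (MonoidAlgebra.mapRingHom G (algebraMap ℚ K))

theorem span_range_rationalRestriction {D : Type*} [Fintype D] [DecidableEq D]
    {ψ : MonoidAlgebra K G →ₐ[K] Matrix D D K} (hψ : Function.Surjective ψ) :
    Submodule.span K (Set.range (rationalRestriction ψ)) = ⊤ := by
  rw [eq_top_iff, ← span_range_of_surjective hψ, Submodule.span_le]
  rintro _ ⟨g, rfl⟩
  refine Submodule.subset_span ⟨MonoidAlgebra.single g 1, ?_⟩
  change ψ (MonoidAlgebra.mapRingHom G (algebraMap ℚ K) _) = _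
  rw [MonoidAlgebra.mapRingHom_single, map_one]

theorem coeff_mapDomain_of {R : Type*} [Semiring R] [Fintype G]
    [DecidableEq (Abelianization G)] (a : MonoidAlgebra R G) (t : Abelianization G) :
    (MonoidAlgebra.mapDomainRingHom R (Abelianization.of (G := G)) a).coeff t =
      ∑ g : G, if Abelianization.of g = t then a.coeff g else 0 := by
  classical
  induction a using MonoidAlgebra.induction_linear with
  | zero => simp
  | add x y hx hy =>
    rw [map_add, MonoidAlgebra.coeff_add, Finsupp.add_apply, hx, hy, ← Finset.sum_add_distrib]
    refine Finset.sum_congr rfl fun g _ => ?_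
    split_ifs <;> simp
  | single g c =>
    rw [MonoidAlgebra.mapDomainRingHom_apply, MonoidAlgebra.mapDomain_single]
    rw [Finset.sum_eq_single g]
    · simp [MonoidAlgebra.coeff_single, Finsupp.single_apply]
    · intro h _ hne
      simp [MonoidAlgebra.coeff_single, hne.symm]
    · simp

theorem mem_integralGroupRing {a : MonoidAlgebra ℚ G} :
    a ∈ integralGroupRing G ↔ ∀ g, ∃ m : ℤ, (m : ℚ) = a.coeff g := by
  have h := MonoidAlgebra.range_map (M := G) (Int.castRingHom ℚ : ℤ →+ ℚ)
  have h' : a ∈ integralGroupRing G ↔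
    a ∈ Set.range (MonoidAlgebra.map (M := G) (Int.castRingHom ℚ : ℤ →+ ℚ)) := Iff.rfl
  rw [h', h]
  rfl

variable (G) in
theorem coe_intCast_center (x : ℤ) :
    (((Int.castRingHom (Subring.center (integralGroupRing G)) x : integralGroupRing G)) :
      MonoidAlgebra ℚ G) = x := by
  simp

variable [Finite G]

variable (G) in
/-- The generalised adjoint of the zero `1 × 1` matrix over `ℚ[G]`. -/
abbrev zeroAdjoint : MonoidAlgebra ℚ G :=
  generalisedAdjoint (0 : Matrix (Fin 1) (Fin 1) (MonoidAlgebra ℚ G)) 0 0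

variable [IsAlgClosure ℚ K]

/-- The generalised adjoint of `0` acts as `1` in the representations of degree `1` and as `0` in the
others. So it is the idempotent `|G'|⁻¹ ∑_{g ∈ G'} g`. -/
theorem rationalRestriction_zeroAdjoint {D : Type*} [Fintype D] [DecidableEq D] [Nonempty D]
    {ψ : MonoidAlgebra K G →ₐ[K] Matrix D D K} (hψ : Function.Surjective ψ) :
    rationalRestriction ψ (zeroAdjoint G) = if Fintype.card D = 1 then 1 else 0 := by
  have key := blockMap_generalisedAdjoint (A := MonoidAlgebra ℚ G) (ψ := rationalRestriction ψ)
    (span_range_rationalRestriction hψ)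
    (0 : Matrix (Fin 1) (Fin 1) (MonoidAlgebra ℚ G))
  rw [map_zero] at key
  have hcard : Fintype.card (Fin 1 × D) = Fintype.card D := by simp
  ext k l
  rw [← blockMap_apply, key]
  split_ifs with h
  · rw [charpolyAdjoint_eq_one (hcard.trans h)]
    simp [Matrix.one_apply]
  · rw [charpolyAdjoint_zero (fun h' => h (hcard.symm.trans h'))]
    rfl

theorem single_mul_zeroAdjoint (K : Type*) [Field K] [CharZero K] [IsAlgClosure ℚ K] {g : G} (hg : g ∈ commutator G) :
    MonoidAlgebra.single g 1 * zeroAdjoint G = zeroAdjoint G := by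
  have hK : IsAlgClosed K := IsAlgClosure.isAlgClosed ℚ
  have hinj : Function.Injective (MonoidAlgebra.mapRingHom G (algebraMap ℚ K)) :=
    MonoidAlgebra.map_injective _ (algebraMap ℚ K).injective
  rw [← sub_eq_zero]
  apply hinj
  rw [map_zero]
  refine eq_zero_of_forall_map_eq_zero fun d _ ψ hψ => ?_
  change rationalRestriction ψ _ = 0
  rw [map_sub, map_mul, rationalRestriction_zeroAdjoint hψ]
  split_ifs with h
  · have : Subsingleton (Fin d) := Fintype.card_le_one_iff_subsingleton.mp h.le
    have hg1 := map_eq_one_of_mem_commutator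
      ((rationalRestriction ψ).toMonoidHom.comp (MonoidAlgebra.of ℚ G))
      (fun a b => by
        ext i j
        rw [Matrix.mul_apply, Matrix.mul_apply]
        refine Finset.sum_congr rfl fun k _ => ?_
        obtain rfl := Subsingleton.elim i k
        obtain rfl := Subsingleton.elim i j
        exact mul_comm _ _) hg
    change rationalRestriction ψ (MonoidAlgebra.single g 1) = 1 at hg1
    rw [hg1, one_mul, sub_self]
  · rw [mul_zero, sub_zero]

theorem map_zeroAdjoint_eq_one (K : Type*) [Field K] [CharZero K] [IsAlgClosure ℚ K] :
    MonoidAlgebra.mapDomainRingHom ℚ (Abelianization.of (G := G)) (zeroAdjoint G) = 1 := by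
  have hK : IsAlgClosed K := IsAlgClosure.isAlgClosed ℚ
  have hinj : Function.Injective
      (MonoidAlgebra.mapRingHom (Abelianization G) (algebraMap ℚ K)) :=
    MonoidAlgebra.map_injective _ (algebraMap ℚ K).injective
  rw [← sub_eq_zero]
  apply hinj
  rw [map_zero]
  refine eq_zero_of_forall_character_eq_zero fun χ => ?_
  rw [map_sub, map_one, map_sub, map_one, sub_eq_zero]
  let ψ : MonoidAlgebra K G →ₐ[K] Matrix (Fin 1) (Fin 1) K :=
    (Algebra.ofId K _).comp (χ.comp (MonoidAlgebra.mapDomainAlgHom K K (Abelianization.of (G := G))))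
  have hψ : Function.Surjective ψ := by
    intro X
    refine ⟨algebraMap K _ (X 0 0), ?_⟩
    rw [AlgHom.commutes]
    ext i j
    obtain rfl := Subsingleton.elim i 0
    obtain rfl := Subsingleton.elim j 0
    exact (Matrix.algebraMap_matrix_apply).trans (by simp)
  have h := rationalRestriction_zeroAdjoint hψ
  rw [if_pos (by simp)] at h
  have h' : algebraMap K (Matrix (Fin 1) (Fin 1) K)
      (χ (MonoidAlgebra.mapDomainRingHom K (Abelianization.of (G := G))
        (MonoidAlgebra.mapRingHom G (algebraMap ℚ K) (zeroAdjoint G)))) = 1 := h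
  rw [← FaithfulSMul.algebraMap_injective K (Matrix (Fin 1) (Fin 1) K) (h'.trans (map_one _).symm)]
  congr 1
  exact congrFun (congrArg DFunLike.coe (MonoidAlgebra.mapRingHom_comp_mapDomainRingHom
    (algebraMap ℚ K) (Abelianization.of (G := G)))) (zeroAdjoint G)

variable (G) in
/-- The coefficients of the generalised adjoint of `0` are constant on `G'`, and they add up to `1`
there, as its image in `ℚ[G/G']` is `1`. -/
theorem natCard_commutator_mul_coeff_zeroAdjoint (K : Type*) [Field K] [CharZero K]
    [IsAlgClosure ℚ K] :
    (Nat.card (commutator G) : ℚ) * (zeroAdjoint G).coeff 1 = 1 := by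
  classical
  have := Fintype.ofFinite G
  have hconst : ∀ g ∈ commutator G, (zeroAdjoint G).coeff g = (zeroAdjoint G).coeff 1 := by
    intro g hg
    conv_lhs => rw [← single_mul_zeroAdjoint K hg]
    rw [MonoidAlgebra.coeff_single_mul_apply]
    simp
  have h := coeff_mapDomain_of (zeroAdjoint G) 1
  rw [map_zeroAdjoint_eq_one K, MonoidAlgebra.coeff_one_one] at h
  have hmem : ∀ g : G, Abelianization.of g = 1 ↔ g ∈ commutator G := fun g =>
    QuotientGroup.eq_one_iff g
  have hsum : ∑ g : G, (if Abelianization.of g = 1 then (zeroAdjoint G).coeff g else 0) =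
      ∑ g : G, if g ∈ commutator G then (zeroAdjoint G).coeff 1 else 0 := by
    refine Finset.sum_congr rfl fun g _ => ?_
    simp only [hmem]
    split_ifs with hg
    · exact hconst g hg
    · rfl
  rw [hsum, ← Finset.sum_filter, Finset.sum_const, nsmul_eq_mul] at h
  rw [h, Nat.card_eq_fintype_card, Fintype.card_subtype]

theorem natCard_commutator_dvd (K : Type*) [Field K] [CharZero K] [IsAlgClosure ℚ K] {x : ℤ}
    (hx : Int.castRingHom (Subring.center (integralGroupRing G)) x ∈
      denominatorIdeal (integralGroupRing G)) : (Nat.card (commutator G) : ℤ) ∣ x := by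
  have h := hx 1 0 (fun _ _ => Subring.zero_mem _) 0 0
  rw [coe_intCast_center, mem_integralGroupRing] at h
  obtain ⟨m, hm⟩ := h 1
  have hc := natCard_commutator_mul_coeff_zeroAdjoint G K
  refine ⟨m, ?_⟩
  have h2 : ((x : MonoidAlgebra ℚ G) * zeroAdjoint G).coeff 1 = x * (zeroAdjoint G).coeff 1 := by
    rw [← zsmul_eq_mul, MonoidAlgebra.coeff_smul_apply, zsmul_eq_mul]
  have h3 : (x : ℚ) = Nat.card (commutator G) * m := by
    rw [hm, h2, mul_left_comm, hc, mul_one]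
  exact_mod_cast h3

end Group

/-! ### Integrality of characteristic polynomials -/

section IntegralCharpoly

theorem charpoly_dvd_pow {N S : Type*} [Fintype N] [DecidableEq N] [CommRing S] (M : Matrix N N S)
    (q : S[X]) (hq : aeval M q = 0) : M.charpoly ∣ q ^ Fintype.card N := by
  -- Specialise `(Y - X) ∣ q(Y) - q(X)` at `Y = M`.
  obtain ⟨Q, hQ⟩ := X_sub_C_dvd_sub_C_eval (a := (X : S[X])) (p := q.map C)
  have h := congrArg (aeval (M.map C : Matrix N N S[X])) hQ
  have e1 : aeval (M.map C : Matrix N N S[X]) (q.map C) = 0 := by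
    have h0 := congrArg (C : S →+* S[X]).mapMatrix hq
    rw [aeval_def, hom_eval₂, map_zero] at h0
    rw [aeval_def, eval₂_map]
    convert h0 using 2
    · ext c i j
      simp [Matrix.algebraMap_matrix_apply, apply_ite]
    · rfl
  rw [map_sub, map_mul, map_sub, e1, aeval_X, aeval_C, aeval_C, eval_map, eval₂_C_X] at h
  have e2 : M.charmatrix * aeval (M.map C : Matrix N N S[X]) Q =
      algebraMap S[X] (Matrix N N S[X]) q := by
    have : M.charmatrix = -((M.map C : Matrix N N S[X]) - algebraMap S[X] _ X) := by
      ext i j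
      simp [Matrix.charmatrix_apply, Matrix.algebraMap_matrix_apply, Matrix.diagonal_apply]
    rw [this, neg_mul, ← h, zero_sub, neg_neg]
  have e3 := congrArg Matrix.det e2
  rw [Matrix.det_mul, Matrix.algebraMap_eq_diagonal, Matrix.det_diagonal] at e3
  simp only [Pi.algebraMap_apply, Algebra.algebraMap_self, RingHom.id_apply, Finset.prod_const,
    Finset.card_univ] at e3
  exact ⟨_, e3.symm⟩

theorem isIntegral_charpoly_coeff {N R S : Type*} [Fintype N] [DecidableEq N] [CommRing R]
    [CommRing S] [Algebra R S] (M : Matrix N N S) (q : R[X]) (hq : q.Monic)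
    (hM : aeval M (q.map (algebraMap R S)) = 0) (j : ℕ) :
    IsIntegral R (M.charpoly.coeff j) := by
  refine isIntegral_coeff_of_dvd (q ^ Fintype.card N) _ (hq.pow _) (Matrix.charpoly_monic M) ?_ j
  rw [Polynomial.map_pow]
  exact charpoly_dvd_pow M _ hM

end IntegralCharpoly

/-! ### Integrality of adjoints over group rings -/

section GroupRingHom

variable {G D R S S' : Type*} [Group G] [Fintype D] [DecidableEq D] [CommRing R] [CommRing S]
  [CommRing S']

/-- The extension of scalars along `h : S → S'` of a matrix representation of `G` over `S`. -/
def extendScalars (h : S →+* S') (τ : G →* Matrix D D S) : G →* Matrix D D S' :=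
  h.mapMatrix.toMonoidHom.comp τ

theorem extendScalars_apply (h : S →+* S') (τ : G →* Matrix D D S) (g : G) :
    extendScalars h τ g = (τ g).map h := rfl

/-- The ring homomorphism `R[G] → M_D(S)`, `∑ c_g g ↦ ∑ f(c_g) τ(g)`, attached to a ring
homomorphism `f : R → S` and a matrix representation `τ` of `G` over `S`. -/
def groupRingHom (f : R →+* S) (τ : G →* Matrix D D S) : MonoidAlgebra R G →+* Matrix D D S :=
  MonoidAlgebra.liftNCRingHom ((algebraMap S (Matrix D D S)).comp f) τ
    fun c g => Algebra.commutes (f c) (τ g)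

theorem groupRingHom_single (f : R →+* S) (τ : G →* Matrix D D S) (g : G) (c : R) :
    groupRingHom f τ (MonoidAlgebra.single g c) = f c • τ g := by
  rw [Algebra.smul_def]
  exact MonoidAlgebra.liftNC_single _ _ _ _

theorem groupRingHom_map (f : R →+* S) (τ : G →* Matrix D D S) (h : S →+* S')
    (x : MonoidAlgebra R G) :
    (groupRingHom f τ x).map h =
      groupRingHom (h.comp f) (extendScalars h τ) x := by
  change h.mapMatrix (groupRingHom f τ x) = _
  induction x using MonoidAlgebra.induction_linear with
  | zero => simp only [map_zero]
  | add x y hx hy => rw [map_add, map_add, map_add, hx, hy]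
  | single g c =>
    rw [groupRingHom_single, groupRingHom_single]
    ext i j
    simp [extendScalars_apply]

theorem groupRingHom_mapRingHom {R' : Type*} [CommRing R'] (f : R →+* S) (τ : G →* Matrix D D S)
    (e : R' →+* R) (x : MonoidAlgebra R' G) :
    groupRingHom f τ (MonoidAlgebra.mapRingHom G e x) = groupRingHom (f.comp e) τ x := by
  induction x using MonoidAlgebra.induction_linear with
  | zero => simp only [map_zero]
  | add x y hx hy => rw [map_add, map_add, map_add, hx, hy]
  | single g c =>
    rw [MonoidAlgebra.mapRingHom_single, groupRingHom_single, groupRingHom_single]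
    rfl

theorem groupRingHom_smul (f : R →+* S) (τ : G →* Matrix D D S) (c : R) (x : MonoidAlgebra R G) :
    groupRingHom f τ (c • x) = f c • groupRingHom f τ x := by
  induction x using MonoidAlgebra.induction_linear with
  | zero => simp only [map_zero, smul_zero]
  | add x y hx hy => rw [smul_add, map_add, map_add, hx, hy, smul_add]
  | single g d =>
    rw [MonoidAlgebra.smul_single, groupRingHom_single, groupRingHom_single, smul_eq_mul, map_mul,
      mul_smul]

theorem groupRingHom_comp_algebraMap (f : R →+* S) (τ : G →* Matrix D D S) :
    (groupRingHom f τ).comp (algebraMap R (MonoidAlgebra R G)) =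
      (algebraMap S (Matrix D D S)).comp f := by
  ext1 c
  rw [RingHom.comp_apply, RingHom.comp_apply, Algebra.algebraMap_eq_smul_one, groupRingHom_smul,
    map_one, Algebra.algebraMap_eq_smul_one]

theorem blockMap_groupRingHom_smul {I : Type*} [Fintype I] [DecidableEq I] (f : R →+* S)
    (τ : G →* Matrix D D S) (c : R) (Y : Matrix I I (MonoidAlgebra R G)) :
    blockMap I (groupRingHom f τ) (c • Y) = f c • blockMap I (groupRingHom f τ) Y := by
  ext ⟨i, k⟩ ⟨j, l⟩
  exact congrFun (congrFun (groupRingHom_smul f τ c (Y i j)) k) l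

theorem blockMap_groupRingHom_map {I : Type*} [Fintype I] [DecidableEq I] (f : R →+* S)
    (τ : G →* Matrix D D S) (h : S →+* S') (Y : Matrix I I (MonoidAlgebra R G)) :
    (blockMap I (groupRingHom f τ) Y).map h = blockMap I
      (groupRingHom (h.comp f) (extendScalars h τ)) Y := by
  ext ⟨i, k⟩ ⟨j, l⟩
  exact congrFun (congrFun (groupRingHom_map f τ h (Y i j)) k) l

theorem isIntegral_charpoly_coeff_blockMap [Finite G] [Algebra R S] {I : Type*} [Fintype I]
    [DecidableEq I] (τ : G →* Matrix D D S) (Y : Matrix I I (MonoidAlgebra R G)) (j : ℕ) :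
    IsIntegral R ((blockMap I (groupRingHom (algebraMap R S) τ) Y).charpoly.coeff j) := by
  obtain ⟨q, hq, hY⟩ : IsIntegral R Y := IsIntegral.of_finite R Y
  refine isIntegral_charpoly_coeff _ q hq ?_ j
  have h := congrArg (blockMap I (groupRingHom (algebraMap R S) τ)) hY
  rw [hom_eval₂, map_zero] at h
  rw [aeval_def, eval₂_map]
  convert h using 2
  ext1 c
  have h1 := blockMap_groupRingHom_smul (I := I) (algebraMap R S) τ c 1
  rw [map_one] at h1
  rw [RingHom.comp_apply, RingHom.comp_apply, Algebra.algebraMap_eq_smul_one,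
    Algebra.algebraMap_eq_smul_one (A := Matrix I I (MonoidAlgebra R G)), h1]

theorem charpolyAdjoint_blockMap_mem {I : Type*} [Fintype I] [DecidableEq I] (f : R →+* S)
    (τ : G →* Matrix D D S) (Y : Matrix I I (MonoidAlgebra R G))
    (h : ∀ j, (blockMap I (groupRingHom f τ) Y).charpoly.coeff j ∈ Set.range f) :
    ∃ W : Matrix I I (MonoidAlgebra R G),
      blockMap I (groupRingHom f τ) W = charpolyAdjoint (blockMap I (groupRingHom f τ) Y) := by
  choose a ha using h
  refine ⟨(-1) ^ (Fintype.card (I × D) + 1) *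
    ∑ j ∈ Finset.Icc 1 (Fintype.card (I × D)), a j • Y ^ (j - 1), ?_⟩
  rw [map_mul, map_pow, map_neg, map_one, map_sum, charpolyAdjoint]
  congr 1
  refine Finset.sum_congr rfl fun j _ => ?_
  rw [blockMap_groupRingHom_smul, ha, map_pow]

end GroupRingHom

section IntegralAdjoint

variable {K G D T I : Type*} [Field K] [Group G] [Finite G] [Fintype D] [DecidableEq D]
  [Fintype I] [DecidableEq I]

/-- If the entries of a matrix come from the group ring of `G` over a polynomial ring with integral
coefficients, then so do those of its adjugate: the characteristic polynomial of the matrix has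
coefficients in `K[x_t]` that are integral over the polynomial ring with integral coefficients, and
this means that their own coefficients are integral. -/
theorem charpolyAdjoint_blockMap_mvPolynomial (ρ : G →* Matrix D D K)
    (Y : Matrix I I (MonoidAlgebra (MvPolynomial T (integralClosure ℤ K)) G)) :
    ∃ W, blockMap I (groupRingHom (MvPolynomial.map (algebraMap (integralClosure ℤ K) K))
        (extendScalars (MvPolynomial.C (σ := T)) ρ)) W =
      charpolyAdjoint (blockMap I
        (groupRingHom (MvPolynomial.map (algebraMap (integralClosure ℤ K) K))
        (extendScalars (MvPolynomial.C (σ := T)) ρ)) Y) := by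
  refine charpolyAdjoint_blockMap_mem _ _ Y fun j => ?_
  let _ : Algebra (MvPolynomial T (integralClosure ℤ K)) (MvPolynomial T K) :=
    MvPolynomial.algebraMvPolynomial
  have h := isIntegral_charpoly_coeff_blockMap
    (extendScalars (MvPolynomial.C (σ := T)) ρ) Y j
  have h' := MvPolynomial.isIntegral_iff_isIntegral_coeff.mp h
  refine MvPolynomial.mem_range_map_iff_coeffs_subset.mpr fun c hc => ?_
  obtain ⟨n, _, rfl⟩ := MvPolynomial.mem_coeffs_iff.mp hc
  have hn : IsIntegral ℤ _ := isIntegral_trans (R := ℤ) (A := integralClosure ℤ K) _ (h' n)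
  exact ⟨⟨_, hn⟩, rfl⟩

/-- The specialisation `R[x_t : t ∈ T] → R[T]`, `x_t ↦ t`. -/
def toMonoidAlgebra (R T : Type*) [CommRing R] [CommMonoid T] :
    MvPolynomial T R →+* MonoidAlgebra R T :=
  (MvPolynomial.aeval fun t => MonoidAlgebra.single t (1 : R)).toRingHom

theorem toMonoidAlgebra_surjective {R T : Type*} [CommRing R] [CommMonoid T] :
    Function.Surjective (toMonoidAlgebra R T) := by
  intro x
  induction x using MonoidAlgebra.induction_linear with
  | zero => exact ⟨0, map_zero _⟩
  | add x y hx hy =>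
    obtain ⟨p, rfl⟩ := hx
    obtain ⟨q, rfl⟩ := hy
    exact ⟨p + q, map_add _ _ _⟩
  | single t c =>
    refine ⟨MvPolynomial.C c * MvPolynomial.X t, ?_⟩
    simp [toMonoidAlgebra, ← MvPolynomial.algebraMap_eq, MonoidAlgebra.single_mul_single]

/-- The analogue over `O[T]`, `O` the ring of integers of `K`, by specialisation from polynomials. The
detour is needed since `O[T]` is not integrally closed in `K[T]`. -/
theorem charpolyAdjoint_blockMap_monoidAlgebra [CommMonoid T] (ρ : G →* Matrix D D K)
    (Y : Matrix I I (MonoidAlgebra (MonoidAlgebra (integralClosure ℤ K) T) G)) :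
    ∃ W, blockMap I (groupRingHom (MonoidAlgebra.mapRingHom T (algebraMap (integralClosure ℤ K) K))
        (extendScalars (MonoidAlgebra.singleOneRingHom (M := T)) ρ)) W =
      charpolyAdjoint (blockMap I
        (groupRingHom (MonoidAlgebra.mapRingHom T (algebraMap (integralClosure ℤ K) K))
        (extendScalars (MonoidAlgebra.singleOneRingHom (M := T)) ρ)) Y) := by
  have hsurj : Function.Surjective
      (MonoidAlgebra.mapRingHom G (toMonoidAlgebra (integralClosure ℤ K) T)) :=
    MonoidAlgebra.map_surjective _ toMonoidAlgebra_surjective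
  choose s hs using hsurj
  obtain ⟨W, hW⟩ := charpolyAdjoint_blockMap_mvPolynomial (T := T) ρ (Y.map s)
  have hcomm : (toMonoidAlgebra K T).comp (MvPolynomial.map (algebraMap (integralClosure ℤ K) K)) =
      (MonoidAlgebra.mapRingHom T (algebraMap (integralClosure ℤ K) K)).comp
        (toMonoidAlgebra (integralClosure ℤ K) T) := by
    apply MvPolynomial.ringHom_ext
    · intro c
      simp [toMonoidAlgebra]
    · intro t
      simp [toMonoidAlgebra]
  have hC : extendScalars (toMonoidAlgebra K T) (extendScalars (MvPolynomial.C (σ := T)) ρ) =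
      extendScalars (MonoidAlgebra.singleOneRingHom (M := T)) ρ := by
    ext g i j
    simp [toMonoidAlgebra, extendScalars_apply]
  have key : ∀ Z : Matrix I I (MonoidAlgebra (MvPolynomial T (integralClosure ℤ K)) G),
      (blockMap I (groupRingHom (MvPolynomial.map (algebraMap (integralClosure ℤ K) K))
        (extendScalars (MvPolynomial.C (σ := T)) ρ)) Z).map
          (toMonoidAlgebra K T) =
      blockMap I (groupRingHom (MonoidAlgebra.mapRingHom T (algebraMap (integralClosure ℤ K) K))
        (extendScalars (MonoidAlgebra.singleOneRingHom (M := T)) ρ))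
        (Z.map (MonoidAlgebra.mapRingHom G (toMonoidAlgebra (integralClosure ℤ K) T))) := by
    intro Z
    rw [blockMap_groupRingHom_map, hcomm, hC]
    ext ⟨i, k⟩ ⟨j, l⟩
    rw [blockMap_apply, blockMap_apply, Matrix.map_apply, groupRingHom_mapRingHom]
  refine ⟨W.map (MonoidAlgebra.mapRingHom G (toMonoidAlgebra (integralClosure ℤ K) T)), ?_⟩
  rw [← key, hW, charpolyAdjoint_map, key, Matrix.map_map]
  congr 2
  ext1 i j
  exact hs (Y i j)

end IntegralAdjoint

/-! ### Twisting by linear characters -/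

section Twist

variable {G D S S' : Type*} [Group G] [Fintype D] [DecidableEq D] [CommRing S] [CommRing S']

/-- The twist `g ↦ u(g) τ(g)` of a matrix representation `τ` by a linear character `u`. -/
def twist (u : G →* S) (τ : G →* Matrix D D S) : G →* Matrix D D S where
  toFun g := u g • τ g
  map_one' := by rw [map_one, map_one, one_smul]
  map_mul' g h := by rw [map_mul, map_mul, smul_mul_smul_comm]

theorem twist_apply (u : G →* S) (τ : G →* Matrix D D S) (g : G) :
    twist u τ g = u g • τ g := rfl

theorem extendScalars_twist (h : S →+* S') (u : G →* S) (τ : G →* Matrix D D S) :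
    extendScalars h (twist u τ) = twist (h.toMonoidHom.comp u) (extendScalars h τ) := by
  ext g i j
  simp [extendScalars_apply, twist_apply]

theorem span_range_twist {K : Type*} [Field K] (u : G →* K) {τ : G →* Matrix D D K}
    (hτ : Submodule.span K (Set.range τ) = ⊤) :
    Submodule.span K (Set.range (twist u τ)) = ⊤ := by
  rw [eq_top_iff, ← hτ, Submodule.span_le]
  rintro _ ⟨g, rfl⟩
  have h : τ g = u g⁻¹ • twist u τ g := by
    rw [twist_apply, smul_smul, ← map_mul, inv_mul_cancel, map_one, one_smul]
  rw [h]
  exact Submodule.smul_mem _ _ (Submodule.subset_span ⟨g, rfl⟩)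

end Twist

section UniversalTwist

variable {K G D T : Type*} [Field K] [Group G] [Fintype D] [DecidableEq D] [CommGroup T]

/-- The matrix representation `g ↦ [p(g)] ρ(g)` of `G` over the group algebra `K[T]`, the
universal twist of `ρ` by the characters of `T`. -/
abbrev universalTwist (p : G →* T) (ρ : G →* Matrix D D K) :
    G →* Matrix D D (MonoidAlgebra K T) :=
  twist ((MonoidAlgebra.of K T).comp p) (extendScalars MonoidAlgebra.singleOneRingHom ρ)

theorem exists_groupRingHom_eq_universalTwist (p : G →* T) (ρ : G →* Matrix D D K)
    (f : ℚ →+* MonoidAlgebra K T) {a : MonoidAlgebra ℚ G} (ha : a ∈ integralGroupRing G) :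
    ∃ w : MonoidAlgebra (MonoidAlgebra (integralClosure ℤ K) T) G,
      groupRingHom (MonoidAlgebra.mapRingHom T (algebraMap (integralClosure ℤ K) K))
        (extendScalars MonoidAlgebra.singleOneRingHom ρ) w =
      groupRingHom f (universalTwist p ρ) a := by
  obtain ⟨z, rfl⟩ := ha
  rw [groupRingHom_mapRingHom]
  induction z using MonoidAlgebra.induction_linear with
  | zero => exact ⟨0, by rw [map_zero, map_zero]⟩
  | add x y hx hy =>
    obtain ⟨v, hv⟩ := hx
    obtain ⟨w, hw⟩ := hy
    exact ⟨v + w, by rw [map_add, map_add, hv, hw]⟩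
  | single g c =>
    refine ⟨MonoidAlgebra.single g (MonoidAlgebra.single (p g) (c : integralClosure ℤ K)), ?_⟩
    rw [groupRingHom_single, groupRingHom_single, twist_apply, smul_smul,
      MonoidAlgebra.mapRingHom_single]
    congr 1
    rw [eq_intCast, ← zsmul_eq_mul, MonoidHom.comp_apply, MonoidAlgebra.of_apply,
      MonoidAlgebra.smul_single, zsmul_one, map_intCast]

end UniversalTwist

section Equivariance

variable {K G D T : Type*} [Field K] [CharZero K] [IsAlgClosure ℚ K] [Group G] [Finite G]
  [Fintype D] [DecidableEq D] [Nonempty D]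

theorem blockMap_groupRingHom_generalisedAdjoint {ρ : G →* Matrix D D K}
    (hρ : Submodule.span K (Set.range ρ) = ⊤) {n : ℕ}
    (H : Matrix (Fin n) (Fin n) (MonoidAlgebra ℚ G)) :
    blockMap (Fin n) (groupRingHom (algebraMap ℚ K) ρ) (generalisedAdjoint H) =
      charpolyAdjoint (blockMap (Fin n) (groupRingHom (algebraMap ℚ K) ρ) H) := by
  refine blockMap_generalisedAdjoint (A := MonoidAlgebra ℚ G)
    (ψ := groupRingHom (algebraMap ℚ K) ρ) ?_ H
  rw [eq_top_iff, ← hρ, Submodule.span_le]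
  rintro _ ⟨g, rfl⟩
  refine Submodule.subset_span ⟨MonoidAlgebra.single g 1, ?_⟩
  rw [groupRingHom_single, map_one, one_smul]

variable [CommGroup T] [Finite T]

/-- The generalised adjoint is compatible with the universal twist: the entries lie in `K[T]`, where
the characters of `T` separate elements. -/
theorem blockMap_universalTwist_generalisedAdjoint (p : G →* T) {ρ : G →* Matrix D D K}
    (hρ : Submodule.span K (Set.range ρ) = ⊤) {n : ℕ}
    (H : Matrix (Fin n) (Fin n) (MonoidAlgebra ℚ G)) (f : ℚ →+* MonoidAlgebra K T) :
    blockMap (Fin n) (groupRingHom f (universalTwist p ρ)) (generalisedAdjoint H) =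
      charpolyAdjoint (blockMap (Fin n) (groupRingHom f (universalTwist p ρ)) H) := by
  have hK : IsAlgClosed K := IsAlgClosure.isAlgClosed ℚ
  -- Every character `χ` of `K[T]` turns the claim into the one for the twist of `ρ` by `χ`.
  have key : ∀ χ : MonoidAlgebra K T →ₐ[K] K,
      (blockMap (Fin n) (groupRingHom f (universalTwist p ρ)) (generalisedAdjoint H)).map χ =
      (charpolyAdjoint (blockMap (Fin n) (groupRingHom f (universalTwist p ρ)) H)).map χ := by
    intro χ
    have e1 := blockMap_groupRingHom_map f (universalTwist p ρ) (χ : MonoidAlgebra K T →+* K)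
      (generalisedAdjoint H)
    have e2 := charpolyAdjoint_map (χ : MonoidAlgebra K T →+* K)
      (blockMap (Fin n) (groupRingHom f (universalTwist p ρ)) H)
    rw [blockMap_groupRingHom_map] at e2
    have hf : (χ : MonoidAlgebra K T →+* K).comp f = algebraMap ℚ K := Subsingleton.elim _ _
    have hext : extendScalars (χ : MonoidAlgebra K T →+* K)
        (extendScalars MonoidAlgebra.singleOneRingHom ρ) = ρ := by
      ext g i j
      exact χ.commutes (ρ g i j)
    rw [extendScalars_twist, hf, hext] at e1 e2
    exact e1.trans ((blockMap_groupRingHom_generalisedAdjoint (span_range_twist _ hρ) H).trans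
      e2.symm)
  ext1 i j
  rw [← sub_eq_zero]
  refine eq_zero_of_forall_character_eq_zero fun χ => ?_
  rw [map_sub, sub_eq_zero]
  exact congrFun (congrFun (key χ) i) j

theorem exists_universalTwist_generalisedAdjoint_eq (p : G →* T) {ρ : G →* Matrix D D K}
    (hρ : Submodule.span K (Set.range ρ) = ⊤) {n : ℕ}
    {H : Matrix (Fin n) (Fin n) (MonoidAlgebra ℚ G)} (hH : ∀ i j, H i j ∈ integralGroupRing G)
    (f : ℚ →+* MonoidAlgebra K T) (i j : Fin n) :
    ∃ w : MonoidAlgebra (MonoidAlgebra (integralClosure ℤ K) T) G,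
      groupRingHom (MonoidAlgebra.mapRingHom T (algebraMap (integralClosure ℤ K) K))
        (extendScalars MonoidAlgebra.singleOneRingHom ρ) w =
      groupRingHom f (universalTwist p ρ) (generalisedAdjoint H i j) := by
  choose Y hY using fun i j => exists_groupRingHom_eq_universalTwist p ρ f (hH i j)
  obtain ⟨W, hW⟩ := charpolyAdjoint_blockMap_monoidAlgebra (T := T) ρ (Matrix.of Y)
  have e : blockMap (Fin n)
      (groupRingHom (MonoidAlgebra.mapRingHom T (algebraMap (integralClosure ℤ K) K))
        (extendScalars MonoidAlgebra.singleOneRingHom ρ)) (Matrix.of Y) =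
      blockMap (Fin n) (groupRingHom f (universalTwist p ρ)) H := by
    refine Matrix.ext fun ⟨i, k⟩ ⟨j, l⟩ => ?_
    exact congrFun (congrFun (hY i j) k) l
  rw [e, ← blockMap_universalTwist_generalisedAdjoint p hρ H f] at hW
  refine ⟨W i j, ?_⟩
  refine Matrix.ext fun k l => ?_
  exact congrFun (congrFun hW (i, k)) (j, l)

end Equivariance

/-! ### Homogeneous components -/

section Homogeneous

variable {K G D T : Type*} [Field K] [Group G] [Fintype D] [DecidableEq D] [CommGroup T]

theorem exists_coeff_groupRingHom_eq {O : Type*} [CommRing O] [Algebra O K]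
    (ρ : G →* Matrix D D K) (t : T) (w : MonoidAlgebra (MonoidAlgebra O T) G) :
    ∃ z : MonoidAlgebra O G, ∀ k l,
      (groupRingHom (MonoidAlgebra.mapRingHom T (algebraMap O K))
        (extendScalars MonoidAlgebra.singleOneRingHom ρ) w k l).coeff t =
      groupRingHom (algebraMap O K) ρ z k l := by
  induction w using MonoidAlgebra.induction_linear with
  | zero =>
    refine ⟨0, fun k l => ?_⟩
    rw [map_zero, map_zero]
    rfl
  | add x y hx hy =>
    obtain ⟨v, hv⟩ := hx
    obtain ⟨w, hw⟩ := hy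
    refine ⟨v + w, fun k l => ?_⟩
    rw [map_add, map_add, Matrix.add_apply, Matrix.add_apply, MonoidAlgebra.coeff_add,
      Finsupp.add_apply, hv, hw]
  | single g c =>
    refine ⟨MonoidAlgebra.single g (c.coeff t), fun k l => ?_⟩
    rw [groupRingHom_single, groupRingHom_single, extendScalars_apply, Matrix.smul_apply,
      Matrix.smul_apply, Matrix.map_apply, smul_eq_mul, smul_eq_mul]
    change (_ * (MonoidAlgebra.single (1 : T) (ρ g k l) : MonoidAlgebra K T)).coeff t = _
    rw [MonoidAlgebra.coeff_mul_single_one, MonoidAlgebra.coeff_mapRingHom]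

variable [CharZero K]

/-- For `a = ∑ a_g g`, the element `∑_{n ∈ ker p} a_{hn} n`: the homogeneous component of `a` of
degree `p(h)`, multiplied by `h⁻¹`. -/
def componentAt (p : G →* T) (h : G) (a : MonoidAlgebra ℚ G) : MonoidAlgebra ℚ p.ker :=
  MonoidAlgebra.comapDomain p.ker.subtype p.ker.subtype_injective
    (MonoidAlgebra.single h⁻¹ 1 * a)

theorem coeff_componentAt (p : G →* T) (h : G) (a : MonoidAlgebra ℚ G) (n : p.ker) :
    (componentAt p h a).coeff n = a.coeff (h * n) := by
  rw [componentAt, MonoidAlgebra.coeff_comapDomain, Finsupp.comapDomain_apply,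
    MonoidAlgebra.coeff_single_mul_apply, one_mul, inv_inv, Subgroup.subtype_apply]

/-- The coefficient at `p h` of the image of `a` under the universal twist is the image under `ρ` of
the homogeneous component of `a` of that degree. -/
theorem coeff_groupRingHom_universalTwist (p : G →* T) (ρ : G →* Matrix D D K)
    (f : ℚ →+* MonoidAlgebra K T) (h : G) (a : MonoidAlgebra ℚ G) (k l : D) :
    (groupRingHom f (universalTwist p ρ) a k l).coeff (p h) =
      (ρ h * groupRingHom (algebraMap ℚ K) (ρ.comp p.ker.subtype) (componentAt p h a)) k l := by
  classical
  have hadd : ∀ x y, componentAt p h (x + y) = componentAt p h x + componentAt p h y := by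
    intro x y
    ext n
    simp [coeff_componentAt]
  induction a using MonoidAlgebra.induction_linear with
  | zero =>
    have : componentAt p h 0 = 0 := by
      ext n
      simp [coeff_componentAt]
    rw [this, map_zero, map_zero, mul_zero]
    rfl
  | add x y hx hy =>
    rw [hadd, map_add, map_add, mul_add, Matrix.add_apply, Matrix.add_apply,
      MonoidAlgebra.coeff_add, Finsupp.add_apply, hx, hy]
  | single g c =>
    have hf : f c = MonoidAlgebra.single 1 (algebraMap ℚ K c) :=
      RingHom.congr_fun (Subsingleton.elim f
        (MonoidAlgebra.singleOneRingHom.comp (algebraMap ℚ K))) c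
    have hL : (groupRingHom f (universalTwist p ρ) (MonoidAlgebra.single g c) k l) =
        MonoidAlgebra.single (p g) (algebraMap ℚ K c * ρ g k l) := by
      rw [groupRingHom_single, twist_apply, hf]
      simp [extendScalars_apply, MonoidAlgebra.single_mul_single]
    rw [hL, MonoidAlgebra.coeff_single, Finsupp.single_apply]
    split_ifs with hgh
    · have hn : h⁻¹ * g ∈ p.ker := by
        rw [MonoidHom.mem_ker, map_mul, map_inv, hgh, inv_mul_cancel]
      have : componentAt p h (MonoidAlgebra.single g c) = MonoidAlgebra.single ⟨h⁻¹ * g, hn⟩ c := by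
        ext n
        rw [coeff_componentAt, MonoidAlgebra.coeff_single, MonoidAlgebra.coeff_single,
          Finsupp.single_apply, Finsupp.single_apply]
        simp only [Subtype.ext_iff, inv_mul_eq_iff_eq_mul]
      rw [this, groupRingHom_single, mul_smul_comm, MonoidHom.comp_apply, ← map_mul,
        Subgroup.subtype_apply, mul_inv_cancel_left, Matrix.smul_apply, smul_eq_mul]
    · have : componentAt p h (MonoidAlgebra.single g c) = 0 := by
        ext n
        rw [coeff_componentAt, MonoidAlgebra.coeff_single, Finsupp.single_apply, if_neg]
        · rfl
        · rintro rfl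
          exact hgh (by rw [map_mul, MonoidHom.mem_ker.mp n.2, mul_one])
      rw [this, map_zero, mul_zero]
      rfl

end Homogeneous

/-! ### Integrality of the homogeneous components -/

section Integrality

/-- If `y ∈ K[N]` is integral over `O`, then so is `|N|` times its coefficient at `1`, the trace of
left multiplication by `y` on `K[N]`. -/
theorem isIntegral_natCard_mul_coeff_one {K N O : Type*} [Field K] [Group N] [Finite N]
    [CommRing O] [Algebra O K] (y : MonoidAlgebra K N) (q : O[X]) (hq : q.Monic)
    (hy : aeval y (q.map (algebraMap O K)) = 0) :
    IsIntegral O ((Nat.card N : K) * y.coeff 1) := by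
  classical
  have := Fintype.ofFinite N
  let b : Module.Basis N K (MonoidAlgebra K N) := MonoidAlgebra.basis N K
  have hM : aeval (Algebra.leftMulMatrix b y) (q.map (algebraMap O K)) = 0 := by
    rw [aeval_algHom_apply, hy, map_zero]
  have hint := isIntegral_charpoly_coeff (Algebra.leftMulMatrix b y) q hq hM (Fintype.card N - 1)
  have htr : (Algebra.leftMulMatrix b y).trace = (Nat.card N : K) * y.coeff 1 := by
    rw [Matrix.trace, Nat.card_eq_fintype_card, ← nsmul_eq_mul, ← Finset.card_univ,
      ← Finset.sum_const]
    refine Finset.sum_congr rfl fun n _ => ?_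
    rw [Matrix.diag_apply, Algebra.leftMulMatrix_eq_repr_mul]
    change (y * MonoidAlgebra.single n 1).coeff n = _
    rw [MonoidAlgebra.coeff_mul_single_apply, mul_inv_cancel, mul_one]
  rw [← htr, Matrix.trace_eq_neg_charpoly_coeff]
  exact hint.neg

theorem groupRingHom_comp_subtype {K D G : Type*} [Field K] [CharZero K] [Fintype D]
    [DecidableEq D] [Group G] (N : Subgroup G) (ψ : MonoidAlgebra K G →ₐ[K] Matrix D D K)
    (a : MonoidAlgebra ℚ N) :
    groupRingHom (algebraMap ℚ K)
        ((ψ.toRingHom.toMonoidHom.comp (MonoidAlgebra.of K G)).comp N.subtype) a =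
      ψ (MonoidAlgebra.mapDomainAlgHom K K N.subtype
        (MonoidAlgebra.mapRingHom N (algebraMap ℚ K) a)) := by
  induction a using MonoidAlgebra.induction_linear with
  | zero => simp only [map_zero]
  | add x y hx hy => rw [map_add, map_add, map_add, map_add, hx, hy]
  | single g c =>
    have h : MonoidAlgebra.mapDomainAlgHom K K N.subtype
        (MonoidAlgebra.single g (algebraMap ℚ K c)) =
        algebraMap ℚ K c • MonoidAlgebra.single (g : G) 1 := by
      rw [MonoidAlgebra.smul_single, smul_eq_mul, mul_one]
      exact MonoidAlgebra.mapDomain_single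
    rw [groupRingHom_single, MonoidAlgebra.mapRingHom_single, h, map_smul]
    rfl

variable {G T : Type*} [Group G] [Finite G] [CommGroup T] [Finite T]

/-- In every representation `ρ` with spanning image, the homogeneous components of the entries of
`H^*`, shifted to degree `1`, act through elements of the image of `O[G]`, which are integral. -/
theorem exists_monic_aeval_groupRingHom_componentAt {K : Type*} [Field K] [CharZero K]
    [IsAlgClosure ℚ K] (p : G →* T) {D : Type*} [Fintype D]
    [DecidableEq D] [Nonempty D] {ρ : G →* Matrix D D K}
    (hρ : Submodule.span K (Set.range ρ) = ⊤) {n : ℕ}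
    {H : Matrix (Fin n) (Fin n) (MonoidAlgebra ℚ G)} (hH : ∀ i j, H i j ∈ integralGroupRing G)
    (i j : Fin n) (h : G) :
    ∃ q : (integralClosure ℤ K)[X], q.Monic ∧
      aeval (groupRingHom (algebraMap ℚ K) (ρ.comp p.ker.subtype)
        (componentAt p h (generalisedAdjoint H i j)))
        (q.map (algebraMap (integralClosure ℤ K) K)) = 0 := by
  let f : ℚ →+* MonoidAlgebra K T := MonoidAlgebra.singleOneRingHom.comp (algebraMap ℚ K)
  obtain ⟨w, hw⟩ := exists_universalTwist_generalisedAdjoint_eq p hρ hH f i j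
  obtain ⟨z, hz⟩ := exists_coeff_groupRingHom_eq ρ (p h) w
  have e : groupRingHom (algebraMap ℚ K) (ρ.comp p.ker.subtype)
      (componentAt p h (generalisedAdjoint H i j)) =
      groupRingHom (algebraMap (integralClosure ℤ K) K) ρ (MonoidAlgebra.single h⁻¹ 1 * z) := by
    have e1 : ρ h * groupRingHom (algebraMap ℚ K) (ρ.comp p.ker.subtype)
        (componentAt p h (generalisedAdjoint H i j)) =
        groupRingHom (algebraMap (integralClosure ℤ K) K) ρ z := by
      ext k l
      rw [← coeff_groupRingHom_universalTwist p ρ f, ← hz, hw]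
    rw [map_mul, ← e1, groupRingHom_single, map_one, one_smul, ← mul_assoc, ← map_mul,
      inv_mul_cancel, map_one, one_mul]
  obtain ⟨q, hq, hq0⟩ := IsIntegral.of_finite (integralClosure ℤ K)
    (MonoidAlgebra.single h⁻¹ 1 * z)
  refine ⟨q, hq, ?_⟩
  have h0 := congrArg (groupRingHom (algebraMap (integralClosure ℤ K) K) ρ) hq0
  rw [hom_eval₂, map_zero] at h0
  rw [groupRingHom_comp_algebraMap] at h0
  rw [e, aeval_def, eval₂_map]
  exact h0

theorem exists_monic_aeval_eq_zero {K O : Type*} [Field K] [CharZero K] [IsAlgClosed K]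
    [CommRing O] [Algebra O K] (a : MonoidAlgebra K G)
    (h : ∀ (d : ℕ) (_ : NeZero d) (ψ : MonoidAlgebra K G →ₐ[K] Matrix (Fin d) (Fin d) K),
      Function.Surjective ψ →
        ∃ q : O[X], q.Monic ∧ aeval (ψ a) (q.map (algebraMap O K)) = 0) :
    ∃ q : O[X], q.Monic ∧ aeval a (q.map (algebraMap O K)) = 0 := by
  obtain ⟨m, d, hd, ⟨Ψ⟩⟩ :=
    IsSemisimpleRing.exists_algEquiv_pi_matrix_of_isAlgClosed K (MonoidAlgebra K G)
  choose q hq hq0 using fun k => h (d k) (hd k) ((Pi.evalAlgHom K _ k).comp Ψ.toAlgHom)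
    ((Function.surjective_eval k).comp Ψ.surjective)
  refine ⟨∏ k, q k, monic_prod_of_monic _ _ fun k _ => hq k, ?_⟩
  apply Ψ.injective
  rw [map_zero]
  funext k
  obtain ⟨r, hr⟩ := Finset.dvd_prod_of_mem q (Finset.mem_univ k)
  have e : ((Pi.evalAlgHom K _ k).comp Ψ.toAlgHom)
      (aeval a ((∏ k, q k).map (algebraMap O K))) = 0 := by
    rw [← aeval_algHom_apply, hr, Polynomial.map_mul, map_mul, hq0, zero_mul]
  exact e

theorem exists_int_eq_natCard_mul_coeff_one (K : Type*) [Field K] [CharZero K] [IsAlgClosure ℚ K]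
    {N : Subgroup G} (y : MonoidAlgebra ℚ N)
    (h : ∀ (d : ℕ) (_ : NeZero d) (ρ : G →* Matrix (Fin d) (Fin d) K),
      Submodule.span K (Set.range ρ) = ⊤ → ∃ q : (integralClosure ℤ K)[X], q.Monic ∧
        aeval (groupRingHom (algebraMap ℚ K) (ρ.comp N.subtype) y)
          (q.map (algebraMap (integralClosure ℤ K) K)) = 0) :
    ∃ m : ℤ, (m : ℚ) = Nat.card N * y.coeff 1 := by
  have hK : IsAlgClosed K := IsAlgClosure.isAlgClosed ℚ
  let yK : MonoidAlgebra K N := MonoidAlgebra.mapRingHom N (algebraMap ℚ K) y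
  let ι : MonoidAlgebra K N →ₐ[K] MonoidAlgebra K G :=
    MonoidAlgebra.mapDomainAlgHom K K N.subtype
  obtain ⟨q, hq, hq0⟩ := exists_monic_aeval_eq_zero (O := integralClosure ℤ K) (ι yK)
    fun d hd ψ hψ => by
      have hρ : Submodule.span K
          (Set.range (ψ.toRingHom.toMonoidHom.comp (MonoidAlgebra.of K G))) = ⊤ :=
        span_range_of_surjective hψ
      obtain ⟨q, hq, hq0⟩ := h d hd _ hρ
      rw [groupRingHom_comp_subtype N ψ y] at hq0
      exact ⟨q, hq, hq0⟩
  have hy0 : aeval yK (q.map (algebraMap (integralClosure ℤ K) K)) = 0 := by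
    have hι : Function.Injective ι := MonoidAlgebra.mapDomain_injective N.subtype_injective
    apply hι
    rw [map_zero, ← aeval_algHom_apply, hq0]
  have hint : IsIntegral ℤ ((Nat.card N : K) * yK.coeff 1) :=
    isIntegral_trans (R := ℤ) (A := integralClosure ℤ K) _
      (isIntegral_natCard_mul_coeff_one yK q hq hy0)
  have hcoeff : (Nat.card N : K) * yK.coeff 1 = algebraMap ℚ K (Nat.card N * y.coeff 1) := by
    rw [MonoidAlgebra.coeff_mapRingHom, map_mul, map_natCast]
  rw [hcoeff, isIntegral_algebraMap_iff (algebraMap ℚ K).injective] at hint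
  exact IsIntegrallyClosed.isIntegral_iff.mp hint

/-- For `H` integral and `p : G → T` with `T` abelian, `|ker p|` clears the denominators of `H^*`. -/
theorem exists_int_eq_natCard_ker_mul_coeff (K : Type*) [Field K] [CharZero K] [IsAlgClosure ℚ K]
    (p : G →* T) {n : ℕ} {H : Matrix (Fin n) (Fin n) (MonoidAlgebra ℚ G)}
    (hH : ∀ i j, H i j ∈ integralGroupRing G) (i j : Fin n) (h : G) :
    ∃ m : ℤ, (m : ℚ) = Nat.card p.ker * (generalisedAdjoint H i j).coeff h := by
  obtain ⟨m, hm⟩ := exists_int_eq_natCard_mul_coeff_one K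
    (componentAt p h (generalisedAdjoint H i j)) fun d _ ρ hρ =>
      exists_monic_aeval_groupRingHom_componentAt p hρ hH i j h
  exact ⟨m, by rw [hm, coeff_componentAt, Subgroup.coe_one, mul_one]⟩

end Integrality

theorem intCast_mem_denominatorIdeal (K : Type*) [Field K] [CharZero K] [IsAlgClosure ℚ K]
    {G : Type*} [Group G] [Finite G] {x : ℤ} (hx : (Nat.card (commutator G) : ℤ) ∣ x) :
    Int.castRingHom (Subring.center (integralGroupRing G)) x ∈
      denominatorIdeal (integralGroupRing G) := by
  intro n H hH i j
  obtain ⟨c, rfl⟩ := hx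
  rw [coe_intCast_center, mem_integralGroupRing]
  intro g
  obtain ⟨m, hm⟩ := exists_int_eq_natCard_ker_mul_coeff K (Abelianization.of (G := G)) hH i j g
  rw [Abelianization.ker_of] at hm
  refine ⟨c * m, ?_⟩
  rw [← zsmul_eq_mul, MonoidAlgebra.coeff_smul_apply, zsmul_eq_mul]
  push_cast
  rw [hm]
  ring

end DenominatorIdeal

end

theorem theoremA (G : Type*) [Group G] [Finite G] :
    (DenominatorIdeal.denominatorIdeal (DenominatorIdeal.integralGroupRing G)).comap
        (Int.castRingHom (Subring.center (DenominatorIdeal.integralGroupRing G))) =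
      Ideal.span {(Nat.card (commutator G) : ℤ)} := by
  have hK : IsAlgClosure ℚ (AlgebraicClosure ℚ) := by
    have h : @IsAlgClosure ℚ (AlgebraicClosure ℚ) _ _ (AlgebraicClosure.instAlgebra ℚ) _ :=
      inferInstance
    convert h
    exact Subsingleton.elim _ _
  ext x
  rw [Ideal.mem_comap, Ideal.mem_span_singleton]
  exact ⟨DenominatorIdeal.natCard_commutator_dvd (AlgebraicClosure ℚ),
    DenominatorIdeal.intCast_mem_denominatorIdeal (AlgebraicClosure ℚ)⟩
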